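/- Let $K$ be an algebraically closed field of arbitrary characteristic, let $n\ge 1$ and $s\ge 0$ be integers, and put $r=sn$, $F=K((t))$, $A=K[[t]]$. Write $e_{cn+i}=t^c e_i$ ($c\in\mathbb Z$, $1\le i\le n$) in $F^n$, put $L_1=A^n$ and $V_s=L_1/t^{r}L_1$, with $K$-basis $e_1,\dots,e_{rn}$, and let $\mathrm{Gr}(r,V_s)$ be the Grassmannian of $r$-dimensional subspaces of $V_s$ in its Plücker embedding. Let $K[\mathrm{Gr}(r,V_s)]$ be its homogeneous coordinate ring, and let $p_I$ denote the Plücker coordinate of an $r$-tuple $I=(1\le i_1<\dots<i_r\le rn)$. Let $s_0,\dots,s_{n-1}$ be the simple reflections of the affine Weyl group acting on $\mathbb Z$ ($s_i$ interchanges $i+kn$ and $i+1+kn$ for all $k\in\mathbb Z$). For $1\le \ell\le r(n-1)+1$ let $\tau_\ell$ be the product of the word obtained by deleting the $\ell-1$ leftmost letters of the reduced word $$w_s=(s_1s_2\cdots s_{n-1}s_0)\cdots(s_1s_2\cdots s_{n-1}s_0)\qquad (s(n-1)\text{ groups}),$$ so that $\tau_1=w_s$ and $\tau_{r(n-1)+1}=\mathrm{id}$.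 (For $n=1$ the word is empty.) Let $I_{\tau_\ell}=\{\tau_\ell(j)+s(n-1)n : j\ge 1\}$, and let $E_{\tau_\ell}\subset F^n$ be the lattice of all vectors whose coefficients along the $e_m$ with $m\notin I_{\tau_\ell}$ are zero. Let $\mathcal B\subset GL_n(A)$ be the subgroup of matrices whose entries above the diagonal lie in $tA$. Every $L$ in the orbit $\mathcal B E_{\tau_\ell}$ satisfies $L_1\supset L\supset t^rL_1$ and $\dim L/t^rL_1=r$. The affine Schubert variety $X(\tau_\ell)$ is the Zariski closure (with reduced structure) of $\{L/t^rL_1 : L\in\mathcal B E_{\tau_\ell}\}$ in $\mathrm{Gr}(r,V_s)$. Extend an $r$-tuple $I$ by $i_{r+k}=rn+k$ for $k\ge1$. Call $I$ admissible if $i_{j+1}-i_j\le n$ for all $j\ge1$, and admissible on $X(\tau_\ell)$ if moreover $p_I|_{X(\tau_\ell)}\ne0$. Let $\mathcal A_{\tau_\ell}$ be the set of tuples admissible on $X(\tau_\ell)$. **Corollary.** There are scalars $a_{I,S}\in K$ ($I$, $S$ $r$-tuples), independent of $\ell$, such that for every $1\le\ell\le r(n-1)+1$: 1. For every non-admissible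 $r$-tuple $I$ the straightening relation $$p_I=\sum_{S\in\mathcal A_{\tau_\ell}}a_{I,S}\,p_S\quad\text{on }X(\tau_\ell)$$ holds, and its coefficients $(a_{I,S})_{S\in\mathcal A_{\tau_\ell}}$ are the only ones for which such a relation holds. 2. The degree-one part of the homogeneous ideal of $X(\tau_\ell)$ in $K[\mathrm{Gr}(r,V_s)]$ is the $K$-linear span of the elements $p_I-\sum_{S\in\mathcal A_{\tau_\ell}}a_{I,S}\,p_S$, for $I$ non-admissible with $p_I|_{X(\tau_\ell)}\neq0$, together with the Plücker coordinates $p_I$ that vanish identically on $X(\tau_\ell)$. -/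

import Mathlib

open scoped LaurentSeries PowerSeries

noncomputable section

namespace AffineSchubert

/-! ### The affine Weyl group and the chain `τ₁ > τ₂ > ⋯ > τ_{r(n-1)+1} = id`, `r = s n` -/

/-- The simple reflection `s_i` of the affine Weyl group acting on `ℤ`: it exchanges
`i + k n` and `i + 1 + k n` for every `k`, and fixes every other integer (`n ≥ 2`). -/
def simpleReflection (n : ℕ) (i m : ℤ) : ℤ :=
  if (n : ℤ) ∣ m - i then m + 1
  else if (n : ℤ) ∣ m - (i + 1) then m - 1
  else m

/-- The reduced word `(s_1 s_2 ⋯ s_{n-1} s_0) ⋯ (s_1 s_2 ⋯ s_{n-1} s_0)`, with `s (n-1)` groups,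
of the Weyl group element `w_s`, as a list of indices. -/
def reducedWord (n s : ℕ) : List ℕ :=
  (List.replicate (s * (n - 1)) (List.range' 1 (n - 1) ++ [0])).flatten

/-- `τ_ℓ` as a bijection of `ℤ`: the product of the word obtained from the reduced word of `w_s`
by deleting its `ℓ - 1` leftmost letters. Thus `τ_1 = w_s`. -/
def tau (n s l : ℕ) : ℤ → ℤ :=
  ((reducedWord n s).drop (l - 1)).foldr (fun i f => simpleReflection n i ∘ f) id

/-- The renormalized index set of `τ_ℓ`: the set `{τ_ℓ(j) | j ≥ 1}` translated by `s (n-1) n`. -/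
def indexSet (n s l : ℕ) : Set ℤ :=
  (fun j => tau n s l j + ((s * (n - 1) * n : ℕ) : ℤ)) '' {j | 1 ≤ j}

/-! ### Schubert cells in the affine Grassmannian

The space `F^n`, `F = K((t))`, has the topological basis `e_{cn+i} = t^c e_i`, `c ∈ ℤ`,
`1 ≤ i ≤ n`. Lattices in `F^n` are regarded as `K`-subspaces. -/

variable (K : Type*) [Field K]

/-- The coordinate subspace `E_I` of `F^n`: the vectors whose coefficient along `e_{cn+i}`
vanishes whenever `cn+i ∉ I`. (`Fin n` is zero-based, whence the `+ 1`.) -/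
def coordSubspace (n : ℕ) (I : Set ℤ) : Submodule K (Fin n → K⸨X⸩) where
  carrier := {v | ∀ (c : ℤ) (i : Fin n), c * n + ((i : ℕ) : ℤ) + 1 ∉ I → (v i).coeff c = 0}
  zero_mem' := by intro c i _; simp
  add_mem' := by
    intro u v hu hv c i h
    simp [hu c i h, hv c i h]
  smul_mem' := by
    intro a v hv c i h
    simp [hv c i h]

/-- The Iwahori subgroup of `GL_n(K[[t]])`: the matrices whose entries above the diagonal have
positive order. -/
def iwahori (n : ℕ) : Set (GL (Fin n) K⟦X⟧) :=
  {g | ∀ i j : Fin n, i < j → PowerSeries.constantCoeff ((g : Matrix _ _ K⟦X⟧) i j) = 0}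

/-- The `K`-linear action of a matrix with entries in `K[[t]]` on `F^n`. -/
def act (n : ℕ) (g : GL (Fin n) K⟦X⟧) : (Fin n → K⸨X⸩) →ₗ[K] (Fin n → K⸨X⸩) where
  toFun v := ((g : Matrix (Fin n) (Fin n) K⟦X⟧).map (HahnSeries.ofPowerSeries ℤ K)).mulVec v
  map_add' u v := Matrix.mulVec_add _ u v
  map_smul' a v := by
    have h : ∀ w : Fin n → K⸨X⸩, a • w = (HahnSeries.C a : K⸨X⸩) • w := by
      intro w
      ext i : 1
      simp
    simp only [h, RingHom.id_apply, Matrix.mulVec_smul]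

/-- The (renormalized) affine Schubert cell of `τ_ℓ`: the Iwahori orbit of the coordinate
lattice of `τ_ℓ`. -/
def affineCell (n s l : ℕ) : Set (Submodule K (Fin n → K⸨X⸩)) :=
  {L | ∃ g ∈ iwahori K n, L = (coordSubspace K n (indexSet n s l)).map (act K n g)}

/-! ### The finite Grassmannian `Gr(sn, V_s)` and its Plücker coordinates

Let `r = s n` and `L_1 = K[[t]]^n`. The space `V_s = L_1 / t^r L_1` has the basis
`e_1, …, e_{rn}` and is identified with `K^{rn}`; the basis vector `e_{m+1}` belongs to the
index `m : Fin (r * n)`. -/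

/-- The truncation `F^n → V_s`, `v ↦` (coefficients of `v` along `e_1, …, e_{rn}`). On `L_1` this
is the quotient map `L_1 → L_1 / t^r L_1`. -/
def trunc (n s : ℕ) : (Fin n → K⸨X⸩) →ₗ[K] (Fin (s * n * n) → K) where
  toFun v := fun m => (v (finProdFinEquiv.symm m).2).coeff ((finProdFinEquiv.symm m).1 : ℕ)
  map_add' u v := by ext m; simp
  map_smul' a v := by ext m; simp

/-- The Grassmannian of `sn`-dimensional subspaces of `V_s`. -/
def grassmannian (n s : ℕ) : Set (Submodule K (Fin (s * n * n) → K)) :=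
  {U | Module.finrank K U = s * n}

/-- `r`-tuples `i_1 < ⋯ < i_r` with entries in `{1, …, rn}`, `r = sn` (entries are stored
zero-based). They index the Plücker coordinates. -/
abbrev Tuple (n s : ℕ) : Type := Fin (s * n) ↪o Fin (s * n * n)

instance (n s : ℕ) : Fintype (Tuple n s) :=
  Fintype.ofInjective (fun I : Tuple n s => (I : Fin (s * n) → Fin (s * n * n)))
    DFunLike.coe_injective

/-- The vector of Plücker coordinates (maximal minors) of an `rn × r` matrix. -/
def pluckerVector {n s : ℕ} (M : Matrix (Fin (s * n * n)) (Fin (s * n)) K) : Tuple n s → K :=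
  fun I => (M.submatrix I id).det

/-- The affine cone, in the space of Plücker coordinates, over a set of points of the
Grassmannian: all scalar multiples of the Plücker vectors of matrices whose column space
is one of the given subspaces. -/
def cone {n s : ℕ} (X : Set (Submodule K (Fin (s * n * n) → K))) : Set (Tuple n s → K) :=
  {x | ∃ U ∈ X, ∃ M : Matrix (Fin (s * n * n)) (Fin (s * n)) K,
    LinearMap.range M.mulVecLin = U ∧ ∃ a : K, x = a • pluckerVector K M}

/-- The homogeneous ideal of the Grassmannian in the polynomial ring in the Plücker
coordinates. -/
def grassmannianIdeal (n s : ℕ) : Ideal (MvPolynomial (Tuple n s) K) :=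
  MvPolynomial.vanishingIdeal K (cone K (grassmannian K n s))

/-- The homogeneous coordinate ring `K[Gr(sn, V_s)]` of the Plücker embedding. -/
abbrev CoordRing (n s : ℕ) : Type _ := MvPolynomial (Tuple n s) K ⧸ grassmannianIdeal K n s

/-- The Plücker coordinate `p_I` as an element of `K[Gr(sn, V_s)]`. -/
def p {n s : ℕ} (I : Tuple n s) : CoordRing K n s :=
  Ideal.Quotient.mk (grassmannianIdeal K n s) (MvPolynomial.X I)

/-- The homogeneous ideal, in `K[Gr(sn, V_s)]`, of a subset of `Gr(sn, V_s)`. -/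
def idealOf {n s : ℕ} (X : Set (Submodule K (Fin (s * n * n) → K))) : Ideal (CoordRing K n s) :=
  (MvPolynomial.vanishingIdeal K (cone K X)).map (Ideal.Quotient.mk (grassmannianIdeal K n s))

/-- The degree-one component of `K[Gr(sn, V_s)]`. -/
def degreeOne (n s : ℕ) : Submodule K (CoordRing K n s) :=
  (MvPolynomial.homogeneousSubmodule (Tuple n s) K 1).map
    (Ideal.Quotient.mkₐ K (grassmannianIdeal K n s)).toLinearMap

/-- The degree-one part of an ideal of `K[Gr(sn, V_s)]`. -/
def degreeOnePart {n s : ℕ} (J : Ideal (CoordRing K n s)) : Submodule K (CoordRing K n s) :=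
  J.restrictScalars K ⊓ degreeOne K n s

/-! ### The Schubert varieties `X(τ_ℓ)` -/

/-- The Schubert cell of `τ_ℓ` as a set of points of `Gr(sn, V_s)`, via
`L ↦ L / t^r L_1`. -/
def cell (n s l : ℕ) : Set (Submodule K (Fin (s * n * n) → K)) :=
  (fun L => L.map (trunc K n s)) '' affineCell K n s l

/-- The affine Schubert variety `X(τ_ℓ)`: the Zariski closure of the cell in `Gr(sn, V_s)`. -/
def schubertVariety (n s l : ℕ) : Set (Submodule K (Fin (s * n * n) → K)) :=
  {U | U ∈ grassmannian K n s ∧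
    cone (n := n) (s := s) K {U} ⊆
      MvPolynomial.zeroLocus K (MvPolynomial.vanishingIdeal K (cone K (cell K n s l)))}

/-- The homogeneous ideal of `X(τ_ℓ)` as a closed subvariety of `Gr(sn, V_s)`. -/
def schubertIdeal (n s l : ℕ) : Ideal (CoordRing K n s) :=
  idealOf K (schubertVariety K n s l)

/-! ### Admissible tuples and straightening relations -/

/-- The infinite increasing sequence `i_1 < i_2 < ⋯` attached to an `r`-tuple, by appending
`rn + 1, rn + 2, …`; the value at `j` is `i_{j+1}`. -/
def fullSequence {n s : ℕ} (I : Tuple n s) (j : ℕ) : ℕ :=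
  if h : j < s * n then (I ⟨j, h⟩ : ℕ) + 1 else s * n * n + (j + 1 - s * n)

/-- `I` is admissible: `i_{j+1} - i_j ≤ n` for all `j ≥ 1`. -/
def IsAdmissible {n s : ℕ} (I : Tuple n s) : Prop :=
  ∀ j, fullSequence I (j + 1) ≤ fullSequence I j + n

/-- `I` is admissible on `X(τ_ℓ)`: it is admissible and `p_I` does not vanish on `X(τ_ℓ)`. -/
def IsAdmissibleOn {n s : ℕ} (l : ℕ) (I : Tuple n s) : Prop :=
  IsAdmissible I ∧ p K I ∉ schubertIdeal K n s l

open Classical in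
/-- The linear form `p_I - ∑_S a_S p_S`, the sum being over the `S` admissible on `X(τ_ℓ)`. -/
def straighteningForm {n s : ℕ} (l : ℕ) (I : Tuple n s) (a : Tuple n s → K) : CoordRing K n s :=
  p K I - ∑ S : Tuple n s with IsAdmissibleOn K l S, a S • p K S

end AffineSchubert

end

noncomputable section

namespace AffineSchubert

/-! ### The index sets of the chain -/

/-! The lattice of τ_ℓ is spanned (topologically) by e_ℓ, t e_ℓ, t² e_ℓ, … and a tail of all e_m
beyond a bound (`exists_mem_indexSet_iff`). The Iwahori group preserves tails and carries e_ℓ to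
every vector x with leading position ℓ. Hence the cell consists of the column spaces of the matrices
with columns x, tx, …, t^{d-1}x and the last r - d basis vectors (`exists_mem_cell_iff`), and a
linear form vanishes on X(τ_ℓ) iff it vanishes on these matrices.

Existence of straightening: multiplication by t acts on the columns of such an M through a strictly
triangular J, so the maximal minors of M(1 + XJ) do not depend on X. Their coefficients in positive
degree are shuffle relations (`ShiftStable.sum_det_eq_zero`). If I has a gap exceeding n, one of
these relations writes p_I through minors whose index tuples have a smaller sum of squares;
iterating leaves only admissible tuples (`exists_straightening`). Only shift-stability enters,
whence coefficients independent of ℓ.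

Uniqueness: let x be generic. By the rearrangement inequality, the diagonal term ∏ x_{i_b - bn} of
the minor of a tuple admissible on X(τ_ℓ) is its unique monomial of least weight, where x_m has
weight m². Admissibility makes i_b - bn weakly decreasing in b, so this monomial determines the
tuple. The minors are therefore triangular in their lowest terms and linearly independent
(`eq_zero_of_sum_dominant_eq_zero`).

The two halves meet in `standard_monomials_degree_one`; the rest is linear algebra in degree one. -/

lemma reducedWord_eq_map_range {n : ℕ} (hn : 1 ≤ n) (s : ℕ) :
    reducedWord n s = (List.range (s * (n - 1) * n)).map (fun i => (i + 1) % n) := by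
  have key : List.range' 1 (n - 1) ++ [0] = (List.range n).map (fun i => (i + 1) % n) := by
    apply List.ext_getElem
    · simp; omega
    · intro i h1 h2
      simp only [List.length_append, List.length_range', List.length_singleton] at h1
      simp only [List.getElem_append, List.length_range', List.getElem_range', List.getElem_map,
        List.getElem_range, List.getElem_singleton]
      split_ifs with h
      · rw [Nat.mod_eq_of_lt (by omega)]; omega
      · have : i + 1 = n := by omega
        simp [this]
  unfold reducedWord
  rw [key]
  generalize s * (n - 1) = k
  induction k with
  | zero => simp
  | succ k ih =>
    rw [List.replicate_succ', List.flatten_append, ih, Nat.succ_mul, List.range_add,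
      List.map_append]
    simp [Nat.add_mod]

lemma tau_step {n : ℕ} (hn : 1 ≤ n) (s l : ℕ) (h1 : 1 ≤ l) (hl : l ≤ s * (n - 1) * n) (j : ℤ) :
    tau n s l j = simpleReflection n ((l % n : ℕ) : ℤ) (tau n s (l + 1) j) := by
  have hlen : (reducedWord n s).length = s * (n - 1) * n := by
    simp [reducedWord_eq_map_range hn]
  unfold tau
  rw [List.drop_eq_getElem_cons (by omega : l - 1 < (reducedWord n s).length)]
  simp only [reducedWord_eq_map_range hn, List.getElem_map, List.getElem_range,
    Nat.sub_add_cancel h1, Nat.add_sub_cancel, List.bind_eq_flatMap, List.pure_def,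
    List.flatMap_cons, List.singleton_append, List.foldr_cons, Function.comp_apply]

lemma tau_last {n : ℕ} (hn : 1 ≤ n) (s : ℕ) (j : ℤ) : tau n s (s * (n - 1) * n + 1) j = j := by
  unfold tau
  rw [List.drop_eq_nil_of_le]
  · rfl
  · simp [reducedWord_eq_map_range hn]

lemma simpleReflection_congr (n : ℕ) {i i' : ℤ} (h : (n : ℤ) ∣ i - i') (m : ℤ) :
    simpleReflection n i m = simpleReflection n i' m := by
  unfold simpleReflection
  have e1 : (n : ℤ) ∣ m - i ↔ (n : ℤ) ∣ m - i' := by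
    rw [show m - i' = (m - i) + (i - i') by ring]; exact (dvd_add_left h).symm
  have e2 : (n : ℤ) ∣ m - (i + 1) ↔ (n : ℤ) ∣ m - (i' + 1) := by
    rw [show m - (i' + 1) = (m - (i + 1)) + (i - i') by ring]; exact (dvd_add_left h).symm
  simp only [e1, e2]

lemma simpleReflection_add (n : ℕ) (i m : ℤ) {T : ℤ} (h : (n : ℤ) ∣ T) :
    simpleReflection n i (m + T) = simpleReflection n i m + T := by
  unfold simpleReflection
  have e1 : (n : ℤ) ∣ m + T - i ↔ (n : ℤ) ∣ m - i := by
    rw [show m + T - i = (m - i) + T by ring]; exact dvd_add_left h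
  have e2 : (n : ℤ) ∣ m + T - (i + 1) ↔ (n : ℤ) ∣ m - (i + 1) := by
    rw [show m + T - (i + 1) = (m - (i + 1)) + T by ring]; exact dvd_add_left h
  simp only [e1, e2]
  split_ifs <;> ring

lemma simpleReflection_involutive {n : ℕ} (hn : 2 ≤ n) (i m : ℤ) :
    simpleReflection n i (simpleReflection n i m) = m := by
  have hnot : ∀ x : ℤ, (n : ℤ) ∣ x → (n : ℤ) ∣ x + 1 → False := by
    intro x h1 h2
    have h3 := (dvd_add_right h1).1 h2
    have := Int.le_of_dvd one_pos h3
    omega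
  unfold simpleReflection
  by_cases h1 : (n : ℤ) ∣ m - i
  · have h2 : ¬ (n : ℤ) ∣ m + 1 - i := fun h => hnot _ h1 (by convert h using 1; ring)
    have h3 : (n : ℤ) ∣ m + 1 - (i + 1) := by convert h1 using 1; ring
    simp only [h1, h2, h3, if_true, if_false]; ring
  · by_cases h2 : (n : ℤ) ∣ m - (i + 1)
    · have h3 : (n : ℤ) ∣ m - 1 - i := by convert h2 using 1; ring
      simp only [h1, h2, h3, if_true, if_false]; ring
    · simp only [h1, h2, if_false]

/-- The renormalizing translation is by a multiple of n, so it commutes with simple reflections, and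
these are involutions once n ≥ 2. -/
lemma mem_indexSet_step {n : ℕ} (hn : 2 ≤ n) (s l : ℕ) (h1 : 1 ≤ l) (hl : l ≤ s * (n - 1) * n)
    (m : ℤ) : m ∈ indexSet n s l ↔ simpleReflection n l m ∈ indexSet n s (l + 1) := by
  have hT : (n : ℤ) ∣ ((s * (n - 1) * n : ℕ) : ℤ) := by push_cast; exact Dvd.intro_left _ rfl
  have hmod : (n : ℤ) ∣ ((l % n : ℕ) : ℤ) - l := by
    push_cast
    rw [Int.emod_def]
    exact ⟨-(l / n), by ring⟩
  have key : ∀ j, tau n s l j + ((s * (n - 1) * n : ℕ) : ℤ) =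
      simpleReflection n l (tau n s (l + 1) j + ((s * (n - 1) * n : ℕ) : ℤ)) := by
    intro j
    rw [simpleReflection_add _ _ _ hT, tau_step (by omega) s l h1 hl,
      simpleReflection_congr n hmod]
  simp only [indexSet, Set.mem_image, Set.mem_ofPred_eq, key]
  constructor
  · rintro ⟨j, hj, rfl⟩
    exact ⟨j, hj, (simpleReflection_involutive hn _ _).symm⟩
  · rintro ⟨j, hj, h⟩
    exact ⟨j, hj, by rw [h, simpleReflection_involutive hn]⟩

/-- The index set of `τ_ℓ` consists of the integers `≥ ℓ` congruent to `ℓ` modulo `n`, and of all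
integers beyond a bound. -/
lemma exists_mem_indexSet_iff {n : ℕ} (hn : 1 ≤ n) (s l : ℕ) (h1 : 1 ≤ l)
    (hl : l ≤ s * n * (n - 1) + 1) :
    ∃ d : ℕ, d ≤ s * n ∧ (l : ℤ) + ((d : ℤ) - 1) * n ≤ ((s * n * (n - 1) + d : ℕ) : ℤ) ∧
      ((s * n * (n - 1) + d : ℕ) : ℤ) < l + d * n ∧
      ∀ m : ℤ, m ∈ indexSet n s l ↔
        ((l : ℤ) ≤ m ∧ (n : ℤ) ∣ m - l) ∨ ((s * n * (n - 1) + d : ℕ) : ℤ) < m := by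
  have hT : s * (n - 1) * n = s * n * (n - 1) := by ring
  have hlast : ∀ m : ℤ, m ∈ indexSet n s (s * n * (n - 1) + 1) ↔
      ((s * n * (n - 1) : ℕ) : ℤ) < m := by
    intro m
    have := tau_last hn s
    rw [hT] at this
    simp only [indexSet, Set.mem_image, Set.mem_ofPred_eq, this, hT]
    constructor
    · rintro ⟨j, hj, rfl⟩; omega
    · intro h; exact ⟨m - ((s * n * (n - 1) : ℕ) : ℤ), by omega, by ring⟩
  rcases Nat.lt_or_ge n 2 with h2 | h2
  · obtain rfl : n = 1 := by omega
    obtain rfl : l = 1 := by simpa using le_antisymm (by simpa using hl) h1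
    refine ⟨0, by omega, by simp, by simp, fun m => ?_⟩
    have := hlast m
    simp only [Nat.sub_self, Nat.mul_zero, Nat.zero_add] at this ⊢
    rw [this]
    simp
    omega
  · set R := s * n * (n - 1) with hR
    -- Descending induction on l, starting from the identity at l = R + 1. The left inequality is
    -- strict because n ≥ 2; for n = 1 it is an equality.
    suffices H : ∀ k l : ℕ, 1 ≤ l → l + k = R + 1 → ∃ d : ℕ,
        (l : ℤ) + ((d : ℤ) - 1) * n < ((R + d : ℕ) : ℤ) ∧
        ((R + d : ℕ) : ℤ) < l + d * n ∧
        ∀ m : ℤ, m ∈ indexSet n s l ↔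
          ((l : ℤ) ≤ m ∧ (n : ℤ) ∣ m - l) ∨ ((R + d : ℕ) : ℤ) < m by
      obtain ⟨d, ha, hb, hc⟩ := H (R + 1 - l) l h1 (by omega)
      refine ⟨d, ?_, ha.le, hb, hc⟩
      -- The left inequality reads (d - 1)(n - 1) < R + 1 - l, and R + 1 - l ≤ sn(n - 1).
      by_contra hd
      push Not at hd
      obtain ⟨q, rfl⟩ : ∃ q, n = q + 1 := ⟨n - 1, by omega⟩
      simp only [Nat.add_sub_cancel] at hR
      have : (s * (q + 1) : ℤ) + 1 ≤ d := by exact_mod_cast hd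
      have h1' : (1 : ℤ) ≤ l := by exact_mod_cast h1
      rw [hR] at ha
      push_cast at ha this
      nlinarith
    intro k
    induction k with
    | zero =>
      intro l _ hk
      obtain rfl : l = R + 1 := by omega
      refine ⟨0, ?_, ?_, fun m => ?_⟩
      · push_cast; have : (2 : ℤ) ≤ n := by exact_mod_cast h2
        linarith
      · push_cast; linarith
      · rw [hlast m]; push_cast
        constructor
        · intro h; right; simpa using h
        · rintro (⟨h, -⟩ | h) <;> omega
    | succ k ih =>
      intro l h1 hk
      obtain ⟨d, ha, hb, hc⟩ := ih (l + 1) (by omega) (by omega)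
      have hn0 : (2 : ℤ) ≤ n := by exact_mod_cast h2
      have hstep : ∀ m, m ∈ indexSet n s l ↔ simpleReflection n l m ∈ indexSet n s (l + 1) :=
        mem_indexSet_step h2 s l h1 (by rw [hT]; omega)
      have hnot : ∀ x : ℤ, (n : ℤ) ∣ x → (n : ℤ) ∣ x + 1 → False := by
        intro x h1 h2
        have h3 := (dvd_add_right h1).1 h2
        have := Int.le_of_dvd one_pos h3
        omega
      push_cast at ha hb
      -- The reflection moves the boundary of the tail only when it exchanges R + d and R + d + 1,
      -- that is, when R + d ≡ l mod n. Then R + d joins the progression, R + d + 1 leaves the tail,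
      -- and d grows by one.
      by_cases hj : (R + d : ℤ) = l + d * n
      · refine ⟨d + 1, ?_, ?_, fun m => ?_⟩
        · push_cast; linarith
        · push_cast; linarith
        · have hd : (n : ℤ) ∣ (R + d : ℤ) - l := ⟨d, by rw [hj]; ring⟩
          rw [hstep, hc]
          unfold simpleReflection
          push_cast
          split_ifs with c1 c2
          · rw [show m + 1 - (l + 1 : ℤ) = m - l by ring]
            have : m ≠ R + d + 1 := by
              rintro rfl
              exact hnot _ hd (by convert c1 using 1; ring)
            have : (l : ℤ) ≤ R + d := by rw [hj]; nlinarith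
            simp only [c1, and_true]
            omega
          · have e : ¬ (n : ℤ) ∣ m - 1 - (l + 1) := fun h => hnot _ h (by convert c2 using 1; ring)
            simp only [c1, e, and_false, false_or]
            omega
          · have : m ≠ R + d + 1 := by
              rintro rfl
              exact c2 (by convert hd using 1; ring)
            simp only [c1, c2, and_false, false_or]
            omega
      · have hlt : (R + d : ℤ) < l + d * n := by
          refine lt_of_le_of_ne ?_ hj
          linarith
        -- Writing R + d = l + nq, the inequalities would squeeze q strictly between d - 1 and d.
        have hnd : ∀ x : ℤ, (n : ℤ) ∣ x - l → x ≠ R + d := by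
          rintro x ⟨q, hq⟩ rfl
          have e1 : (R + d : ℤ) = l + n * q := by linarith
          have q1 : q < d := by nlinarith
          have q2 : (d : ℤ) - 1 < q := by nlinarith
          omega
        refine ⟨d, ?_, ?_, fun m => ?_⟩
        · push_cast; linarith
        · push_cast; linarith
        · rw [hstep, hc]
          unfold simpleReflection
          push_cast
          split_ifs with c1 c2
          · rw [show m + 1 - (l + 1 : ℤ) = m - l by ring]
            have := hnd m c1
            simp only [c1, and_true]
            omega
          · have e : ¬ (n : ℤ) ∣ m - 1 - (l + 1) := fun h => hnot _ h (by convert c2 using 1; ring)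
            have := hnd (m - 1) (by convert c2 using 1; ring)
            simp only [c1, e, and_false, false_or]
            omega
          · simp only [c1, c2, and_false, false_or]

/-! ### Shuffle relations between the maximal minors of a shift-stable matrix -/

/-- The matrix whose row `m` is the row `m - n` of `M`, or zero if `m < n`. -/
def shiftRows {R : Type*} [Zero R] {N r : ℕ} (n : ℕ) (M : Matrix (Fin N) (Fin r) R) :
    Matrix (Fin N) (Fin r) R :=
  fun m b => if n ≤ (m : ℕ) then M ⟨m - n, by omega⟩ b else 0

/-- The shift by `n` acts on the columns of `M` through a strictly lower triangular matrix. -/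
def ShiftStable {R : Type*} [CommRing R] {N r : ℕ} (n : ℕ) (M : Matrix (Fin N) (Fin r) R) :
    Prop :=
  ∃ J : Matrix (Fin r) (Fin r) R, (∀ i j, i ≤ j → J i j = 0) ∧ shiftRows n M = M * J

/-- The matrix with the rows of `W` at the indices in `s` and the rows of `U` elsewhere. -/
def selectRows {R : Type*} {r : ℕ} (s : Finset (Fin r)) (W U : Matrix (Fin r) (Fin r) R) :
    Matrix (Fin r) (Fin r) R :=
  fun i j => if i ∈ s then W i j else U i j

/-- Multilinear expansion over rows: each row contributes either its U part or X times its W part.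
-/
lemma det_add_X_smul {R : Type*} [CommRing R] {r : ℕ} (U W : Matrix (Fin r) (Fin r) R) :
    (U.map Polynomial.C + (Polynomial.X : Polynomial R) • W.map Polynomial.C).det =
      ∑ s : Finset (Fin r), Polynomial.C ((selectRows s W U).det) *
        Polynomial.X ^ s.card := by
  rw [add_comm]
  change (Matrix.detRowAlternating (R := Polynomial R)).toMultilinearMap
    ((fun i => (Polynomial.X : Polynomial R) • (W.map Polynomial.C) i) +
      fun i => (U.map Polynomial.C) i) = _
  rw [MultilinearMap.map_add_univ]
  refine Finset.sum_congr rfl fun s _ => ?_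
  set Y : Fin r → Fin r → Polynomial R :=
    fun i j => Polynomial.C (if i ∈ s then W i j else U i j) with hY
  have h : s.piecewise (fun i => (Polynomial.X : Polynomial R) • (W.map Polynomial.C) i)
        (fun i => (U.map Polynomial.C) i) =
      s.piecewise (fun i => (fun _ => (Polynomial.X : Polynomial R)) i • Y i) Y := by
    funext i j
    by_cases hi : i ∈ s <;> simp [Finset.piecewise, hi, Y]
  rw [h]
  refine (MultilinearMap.map_piecewise_smul _ _ _ _).trans ?_
  rw [Finset.prod_const, smul_eq_mul, mul_comm]
  congr 1
  exact (RingHom.map_det Polynomial.C (selectRows s W U)).symm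

/-- Since 1 + XJ is unitriangular, the minor of M + X · (shifted M) on the rows f equals that of M.
It is constant in X, and the sum is its coefficient of X^k. -/
theorem ShiftStable.sum_det_eq_zero {R : Type*} [CommRing R] {N r n : ℕ}
    {M : Matrix (Fin N) (Fin r) R} (hM : ShiftStable n M) (f : Fin r → Fin N) {k : ℕ}
    (hk : k ≠ 0) :
    ∑ s ∈ Finset.powersetCard k (Finset.univ : Finset (Fin r)),
      Matrix.det (selectRows s ((shiftRows n M).submatrix f id) (M.submatrix f id)) = 0 := by
  obtain ⟨J, hJ, hMJ⟩ := hM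
  have h1 : (((M.submatrix f id).map Polynomial.C +
      (Polynomial.X : Polynomial R) • ((shiftRows n M).submatrix f id).map Polynomial.C)).det =
      Polynomial.C (M.submatrix f id).det := by
    have e : (M.submatrix f id).map Polynomial.C +
        (Polynomial.X : Polynomial R) • ((shiftRows n M).submatrix f id).map Polynomial.C =
        (M.submatrix f id).map Polynomial.C *
          (1 + (Polynomial.X : Polynomial R) • J.map Polynomial.C) := by
      rw [hMJ, mul_add, mul_one, Matrix.mul_smul]
      congr 2
      rw [← Matrix.map_mul]
      rfl
    rw [e, Matrix.det_mul]
    have h2 : (1 + (Polynomial.X : Polynomial R) • J.map Polynomial.C).det = 1 := by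
      rw [Matrix.det_of_isLowerTriangular]
      · refine Finset.prod_eq_one fun i _ => ?_
        simp [hJ i i le_rfl]
      · intro i j hij
        have hij' : i < j := by simpa using hij
        simp [hJ i j hij'.le, Matrix.one_apply_ne hij'.ne]
    rw [h2, mul_one]
    exact (RingHom.map_det Polynomial.C _).symm
  rw [det_add_X_smul] at h1
  have h2 := congrArg (fun q => Polynomial.coeff q k) h1
  simp only [Polynomial.finsetSum_coeff, Polynomial.coeff_C_mul, Polynomial.coeff_X_pow,
    Polynomial.coeff_C, if_neg hk, mul_ite, mul_one, mul_zero] at h2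
  rw [← Finset.sum_filter] at h2
  convert h2 using 2
  ext s
  simp [Finset.mem_powersetCard, eq_comm]

/-! ### Straightening -/

/-- The appended part of the sequence has steps of 1, so a violation starts at a genuine entry. The
room above that entry, also when it is the last one, lets the entries up to j be raised by n without
leaving the index range. -/
lemma exists_gap_of_not_isAdmissible {n s : ℕ} (hn : 1 ≤ n) {I : Tuple n s}
    (hI : ¬ IsAdmissible I) :
    ∃ j : Fin (s * n), (I j : ℕ) + n < s * n * n ∧ ∀ a, j < a → (I j : ℕ) + n < I a := by
  simp only [IsAdmissible, not_forall, not_le] at hI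
  obtain ⟨j, hj⟩ := hI
  unfold fullSequence at hj
  by_cases h1 : j < s * n
  · refine ⟨⟨j, h1⟩, ?_, fun a ha => ?_⟩
    · split_ifs at hj with h2
      · have := (I ⟨j + 1, h2⟩).isLt; omega
      · omega
    · have ha' : j + 1 ≤ (a : ℕ) := ha
      have h2 : j + 1 < s * n := by omega
      have : I ⟨j + 1, h2⟩ ≤ I a := I.monotone (Fin.le_def.2 ha')
      have : (I ⟨j + 1, h2⟩ : ℕ) ≤ I a := this
      simp only [h1, h2, dif_pos] at hj
      omega
  · have h2 : ¬ j + 1 < s * n := by omega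
    simp only [h1, h2, dif_neg, not_false_eq_true] at hj
    omega

/-- Lowering an entry v by n changes v² by n² - 2nv, so lowering larger entries decreases the sum of
squares more. Entries outside S exceed c and those in S do not, so S is the worst choice of its
cardinality. -/
lemma sum_sq_lt_of_shift {r n c : ℕ} (hn : 1 ≤ n) (f g h : Fin r → ℕ) (S T : Finset (Fin r))
    (hcard : T.card = S.card) (hne : T ≠ S) (hS : ∀ a ∈ S, f a ≤ c) (hS' : ∀ a ∉ S, c < f a)
    (hg : ∀ a, g a = if a ∈ S then f a - n else f a) (hgn : ∀ a ∈ S, n ≤ f a)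
    (hh : ∀ a, h a = if a ∈ T then f a - n else f a) (hhn : ∀ a ∈ T, n ≤ f a) :
    ∑ a, h a ^ 2 < ∑ a, g a ^ 2 := by
  have key : ∑ a, ((h a : ℤ) ^ 2 - (g a : ℤ) ^ 2) <
      ∑ a, (2 * n * c - n ^ 2 : ℤ) * ((if a ∈ S then 1 else 0) - (if a ∈ T then 1 else 0)) := by
    have hh' : ∀ a, (h a : ℤ) = f a - n * (if a ∈ T then 1 else 0) := by
      intro a; rw [hh]
      split_ifs with h1
      · rw [Nat.cast_sub (hhn a h1)]; ring
      · ring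
    have hg' : ∀ a, (g a : ℤ) = f a - n * (if a ∈ S then 1 else 0) := by
      intro a; rw [hg]
      split_ifs with h1
      · rw [Nat.cast_sub (hgn a h1)]; ring
      · ring
    have hn' : (1 : ℤ) ≤ n := by exact_mod_cast hn
    obtain ⟨b, hbT, hbS⟩ : ∃ b ∈ T, b ∉ S := by
      by_contra hcon
      push Not at hcon
      exact hne (Finset.eq_of_subset_of_card_le hcon hcard.ge)
    refine Finset.sum_lt_sum (fun a _ => ?_) ⟨b, Finset.mem_univ _, ?_⟩
    · rw [hh', hg']
      split_ifs with h1 h2 h2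
      · nlinarith
      · have := hS' a h2
        have : (c : ℤ) < f a := by exact_mod_cast this
        nlinarith
      · have := hS a h2
        have : (f a : ℤ) ≤ c := by exact_mod_cast this
        nlinarith
      · nlinarith
    · rw [hh', hg', if_pos hbT, if_neg hbS]
      have := hS' b hbS
      have : (c : ℤ) < f b := by exact_mod_cast this
      nlinarith
  rw [← Finset.mul_sum, Finset.sum_sub_distrib, Finset.sum_sub_distrib] at key
  simp only [Finset.sum_ite_mem, Finset.univ_inter, Finset.sum_const, nsmul_eq_mul, mul_one,
    hcard, sub_self, mul_zero] at key
  have := sub_neg.1 key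
  exact_mod_cast this

/-- Every minor of a shift-stable matrix is a universal linear combination of the admissible
maximal minors. -/
theorem exists_straightening (K : Type*) [Field K] {n s : ℕ} (hn : 1 ≤ n)
    (f : Fin (s * n) → Fin (s * n * n)) :
    ∃ a : Tuple n s → K, (∀ S, ¬ IsAdmissible S → a S = 0) ∧
      ∀ M : Matrix (Fin (s * n * n)) (Fin (s * n)) K, ShiftStable n M →
        (M.submatrix f id).det = ∑ S, a S * pluckerVector K M S := by
  -- induction hq The induction is on the sum of squares of the row indices. It runs over arbitrary
  -- maps f because shuffle relations produce unsorted rows, possibly with repetitions.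
  classical
  induction hq : ∑ a, (f a : ℕ) ^ 2 using Nat.strong_induction_on generalizing f with
  | _ q ih =>
  by_cases hf : Function.Injective f
  swap
  · refine ⟨0, fun _ _ => rfl, fun M _ => ?_⟩
    simp only [Function.Injective, not_forall] at hf
    obtain ⟨i, j, hij, hne⟩ := hf
    simp only [Pi.zero_apply, zero_mul, Finset.sum_const_zero]
    exact Matrix.det_zero_of_row_eq hne (by ext b; simp [hij])
  set σ := Tuple.sort f with hσ
  have hmono : StrictMono (f ∘ σ) :=
    (Tuple.monotone_sort f).strictMono_of_injective (hf.comp σ.injective)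
  set I : Tuple n s := OrderEmbedding.ofStrictMono (f ∘ σ) hmono with hIdef
  suffices H : ∃ a : Tuple n s → K, (∀ S, ¬ IsAdmissible S → a S = 0) ∧
      ∀ M : Matrix (Fin (s * n * n)) (Fin (s * n)) K, ShiftStable n M →
        pluckerVector K M I = ∑ S, a S * pluckerVector K M S by
    obtain ⟨a, ha, hM⟩ := H
    refine ⟨fun S => ((Equiv.Perm.sign σ : ℤ) : K) * a S, fun S hS => by simp [ha S hS],
      fun M h => ?_⟩
    have h1 : pluckerVector K M I =
        ((Equiv.Perm.sign σ : ℤ) : K) * (M.submatrix f id).det := by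
      rw [← Matrix.det_permute]; rfl
    have h2 : ((Equiv.Perm.sign σ : ℤ) : K) * ((Equiv.Perm.sign σ : ℤ) : K) = 1 := by
      rw [← Int.cast_mul, ← Units.val_mul, Int.units_mul_self]; simp
    calc (M.submatrix f id).det
        = ((Equiv.Perm.sign σ : ℤ) : K) * pluckerVector K M I := by
          rw [h1, ← mul_assoc, h2, one_mul]
      _ = _ := by rw [hM M h, Finset.mul_sum]; simp only [mul_assoc]
  have hqI : ∑ a, (I a : ℕ) ^ 2 = q := by
    rw [← hq]
    exact Equiv.sum_comp σ (fun a => (f a : ℕ) ^ 2)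
  by_cases hI : IsAdmissible I
  · refine ⟨Pi.single I 1, fun S hS => ?_, fun M _ => ?_⟩
    · rw [Pi.single_eq_of_ne]; rintro rfl; exact hS hI
    · simp [Pi.single_apply]
  obtain ⟨j, hj1, hj2⟩ := exists_gap_of_not_isAdmissible hn hI
  have hle : ∀ a, a ≤ j → (I a : ℕ) ≤ I j := fun a ha => I.monotone ha
  set S₀ : Finset (Fin (s * n)) := Finset.Iic j with hS₀
  -- Raise every entry up to the gap by n. Lowering exactly these again gives I back; the gap
  -- guarantees that they stay below all the others.
  set f' : Fin (s * n) → Fin (s * n * n) := fun a =>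
    if h : a ≤ j then ⟨I a + n, by have := hle a h; omega⟩ else I a with hf'
  have hf'1 : ∀ a ∈ S₀, (f' a : ℕ) = I a + n := by
    intro a ha
    simp only [hS₀, Finset.mem_Iic] at ha
    simp [hf', ha]
  have hf'2 : ∀ a ∉ S₀, f' a = I a := by
    intro a ha
    simp only [hS₀, Finset.mem_Iic] at ha
    simp only [hf', dif_neg ha]
  have hterm : ∀ T ∈ (Finset.powersetCard S₀.card Finset.univ).erase S₀,
      ∃ a : Tuple n s → K, (∀ S, ¬ IsAdmissible S → a S = 0) ∧
      ∀ M : Matrix (Fin (s * n * n)) (Fin (s * n)) K, ShiftStable n M →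
        Matrix.det (selectRows T ((shiftRows n M).submatrix f' id) (M.submatrix f' id)) =
          ∑ S, a S * pluckerVector K M S := by
    intro T hT
    rw [Finset.mem_erase, Finset.mem_powersetCard] at hT
    -- An index lowered below zero gives a zero row, so that term of the relation drops out.
    by_cases hneg : ∃ a ∈ T, (f' a : ℕ) < n
    · obtain ⟨a, haT, ha⟩ := hneg
      refine ⟨0, fun _ _ => rfl, fun M _ => ?_⟩
      simp only [Pi.zero_apply, zero_mul, Finset.sum_const_zero]
      refine Matrix.det_eq_zero_of_row_eq_zero a fun b => ?_
      simp [selectRows, haT, shiftRows, Nat.not_le.2 ha]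
    · push Not at hneg
      set g : Fin (s * n) → Fin (s * n * n) := fun a =>
        if a ∈ T then ⟨f' a - n, by omega⟩ else f' a with hg
      have hlt : ∑ a, (g a : ℕ) ^ 2 < q := by
        rw [← hqI]
        refine sum_sq_lt_of_shift (c := I j + n) hn (fun a => (f' a : ℕ)) _ _ S₀ T hT.2.2 hT.1
          ?_ ?_ ?_ ?_ ?_ hneg
        · intro a ha
          rw [hf'1 a ha]
          have := hle a (by simpa [hS₀] using ha)
          omega
        · intro a ha
          simp only [hf'2 a ha]
          exact hj2 a (by simpa [hS₀] using ha)
        · intro a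
          split_ifs with ha
          · rw [hf'1 a ha]; omega
          · rw [hf'2 a ha]
        · intro a ha
          rw [hf'1 a ha]; omega
        · intro a
          simp only [hg]
          split_ifs <;> rfl
      obtain ⟨a, ha, hM⟩ := ih _ hlt g rfl
      refine ⟨a, ha, fun M h => ?_⟩
      rw [← hM M h]
      congr 1
      funext i b
      by_cases hi : i ∈ T
      · simp [selectRows, hi, shiftRows, hneg i hi, hg]
      · simp [selectRows, hi, hg]
  choose! A hA1 hA2 using hterm
  refine ⟨fun S => -∑ T ∈ (Finset.powersetCard S₀.card Finset.univ).erase S₀, A T S,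
    fun S hS => ?_, fun M h => ?_⟩
  · beta_reduce
    rw [Finset.sum_eq_zero fun T hT => hA1 T hT S hS, neg_zero]
  · have hrel := h.sum_det_eq_zero f' (k := S₀.card)
      (Finset.card_ne_zero_of_mem (a := j) (by simp [hS₀]))
    rw [← Finset.add_sum_erase _ _ (a := S₀) (by simp [Finset.mem_powersetCard])] at hrel
    have hmain : Matrix.det (selectRows S₀ ((shiftRows n M).submatrix f' id)
        (M.submatrix f' id)) = pluckerVector K M I := by
      unfold pluckerVector
      congr 1
      funext i b
      by_cases hi : i ∈ S₀
      · simp [selectRows, hi, shiftRows, hf'1 i hi]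
      · simp [selectRows, hi, hf'2 i hi]
    rw [hmain, Finset.sum_congr rfl (fun T hT => hA2 T hT M h)] at hrel
    rw [eq_neg_of_add_eq_zero_left hrel, Finset.sum_comm]
    simp only [neg_mul, Finset.sum_neg_distrib, Finset.sum_mul]

/-! ### Matrices of cyclic lattices -/

/-- The matrix whose first `d` columns are the shifts of the vector `x` by multiples of `n`, and
whose last `r - d` columns are the last `r - d` standard basis vectors. -/
def cyclicMatrix {R : Type*} [Zero R] [One R] (N r n d : ℕ) (x : ℕ → R) :
    Matrix (Fin N) (Fin r) R :=
  fun m b => if (b : ℕ) < d then (if b * n ≤ (m : ℕ) then x (m - b * n) else 0)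
    else if (m : ℕ) + r = N + b then 1 else 0

/-- The shift sends column b to column b + 1 while b + 1 < d. By `hd` and `hx` the shift of column d
- 1 is supported in the last r - d coordinates, as are the shifts of the basis columns. There the
remaining columns are standard basis vectors, so the coefficients in J are read off directly. -/
lemma shiftStable_cyclicMatrix {R : Type*} [CommRing R] {N r n d l : ℕ} (hr : r ≤ N) (hdr : d ≤ r)
    (hn : 1 ≤ n) (hd : N + d ≤ l + d * n + r) {x : ℕ → R} (hx : ∀ m < l, x m = 0) :
    ShiftStable n (cyclicMatrix N r n d x) := by
  set M := cyclicMatrix N r n d x with hM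
  refine ⟨Matrix.of fun i b => if (b : ℕ) + 1 < d then (if (i : ℕ) = b + 1 then 1 else 0)
    else if d ≤ (i : ℕ) ∧ b < i then shiftRows n M ⟨N + i - r, by omega⟩ b else 0, ?_, ?_⟩
  · intro i j hij
    have hij' : (i : ℕ) ≤ j := hij
    rw [Matrix.of_apply]
    split_ifs with h1 h2 h2
    · omega
    · rfl
    · exact absurd h2.2 (not_lt.2 hij)
    · rfl
  · ext m b
    rw [Matrix.mul_apply]
    simp only [Matrix.of_apply]
    by_cases hb : (b : ℕ) + 1 < d
    · simp only [hb, if_true]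
      have hbr : (b : ℕ) + 1 < r := by omega
      rw [Finset.sum_eq_single ⟨b + 1, hbr⟩]
      · have hb' : (b : ℕ) < d := by omega
        simp only [shiftRows, hM, cyclicMatrix, hb, hb', if_true, mul_one, Nat.succ_mul]
        by_cases h1 : n ≤ (m : ℕ)
        · by_cases h2 : (b : ℕ) * n ≤ m - n
          · rw [if_pos h1, if_pos h2, if_pos (by omega)]
            congr 1; omega
          · rw [if_pos h1, if_neg h2, if_neg (by omega)]
        · rw [if_neg h1, if_neg (by omega)]
      · intro i _ hi
        rw [if_neg, mul_zero]
        intro h; exact hi (Fin.ext h)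
      · simp
    · simp only [hb, if_false]
      by_cases hm : N + d ≤ (m : ℕ) + r
      · rw [Finset.sum_eq_single ⟨m + r - N, by omega⟩]
        · have e1 : M m ⟨m + r - N, by omega⟩ = 1 := by
            simp only [hM, cyclicMatrix]
            rw [if_neg (by omega), if_pos (by omega)]
          have e2 : (⟨N + (m + r - N) - r, by omega⟩ : Fin N) = m := Fin.ext (by simp; omega)
          rw [e1, one_mul]
          simp only [e2]
          split_ifs with h
          · rfl
          · have h3 : (m : ℕ) + r ≤ N + b := by
              have : ¬ ((b : ℕ) < m + r - N) := fun h' => h ⟨by omega, h'⟩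
              omega
            simp only [shiftRows, hM, cyclicMatrix]
            rw [if_neg (by omega : ¬ ((b : ℕ) < d))]
            split_ifs with h4 h5
            · omega
            · rfl
            · rfl
        · intro i _ hi
          by_cases hi' : d ≤ (i : ℕ)
          · have : M m i = 0 := by
              simp only [hM, cyclicMatrix]
              rw [if_neg (by omega), if_neg]
              intro h; exact hi (Fin.ext (by simp; omega))
            rw [this, zero_mul]
          · rw [if_neg (fun h => hi' h.1), mul_zero]
        · simp
      · rw [Finset.sum_eq_zero]
        · simp only [shiftRows, hM, cyclicMatrix]
          by_cases h1 : n ≤ (m : ℕ)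
          · rw [if_pos h1]
            by_cases h2 : (b : ℕ) < d
            · rw [if_pos h2]
              by_cases h3 : (b : ℕ) * n ≤ m - n
              · rw [if_pos h3]
                apply hx
                obtain rfl : d = b + 1 := by omega
                rw [Nat.succ_mul] at hd
                omega
              · rw [if_neg h3]
            · rw [if_neg h2, if_neg (by omega)]
          · rw [if_neg h1]
        · intro i _
          by_cases hi' : d ≤ (i : ℕ)
          · have : M m i = 0 := by
              simp only [hM, cyclicMatrix]
              rw [if_neg (by omega), if_neg (by omega)]
            rw [this, zero_mul]
          · rw [if_neg (fun h => hi' h.1), mul_zero]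

/-- The rows at the leading positions l + bn and at the last r - d indices form a lower triangular
submatrix whose diagonal entries are x l or 1. -/
lemma injective_mulVecLin_cyclicMatrix {K : Type*} [Field K] {N r n d l : ℕ} (hr : r ≤ N) (hdr : d ≤ r)
    (hn : 1 ≤ n) (hd : ∀ k < d, l + k * n + r < N + d) {x : ℕ → K}
    (hx : ∀ m < l, x m = 0) (hl : x l ≠ 0) :
    Function.Injective (cyclicMatrix N r n d x).mulVecLin := by
  set M := cyclicMatrix N r n d x with hM
  set ρ : Fin r → Fin N := fun b =>
    if h : (b : ℕ) < d then ⟨l + b * n, by have := hd b h; omega⟩ else ⟨N + b - r, by omega⟩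
    with hρ
  have hdet : (M.submatrix ρ id).det ≠ 0 := by
    rw [Matrix.det_of_isLowerTriangular]
    · refine Finset.prod_ne_zero_iff.2 fun b _ => ?_
      simp only [Matrix.submatrix_apply, id, hM, cyclicMatrix, hρ]
      by_cases hb : (b : ℕ) < d
      · simpa [hb] using hl
      · simp only [hb, dif_neg, if_false, not_false_eq_true]
        rw [if_pos (by omega)]
        exact one_ne_zero
    · intro a b hab
      have hab' : (a : ℕ) < b := by simpa using hab
      simp only [Matrix.submatrix_apply, id, hM, cyclicMatrix, hρ]
      by_cases ha : (a : ℕ) < d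
      · simp only [ha, dif_pos]
        by_cases hb : (b : ℕ) < d
        · rw [if_pos hb]
          split_ifs with h
          · apply hx
            have : (a : ℕ) * n < b * n := Nat.mul_lt_mul_of_pos_right hab' hn
            omega
          · rfl
        · rw [if_neg hb, if_neg]
          have := hd a ha
          omega
      · simp only [ha, dif_neg, not_false_eq_true]
        rw [if_neg (by omega), if_neg (by omega)]
  rw [injective_iff_map_eq_zero]
  intro v hv
  refine Matrix.eq_zero_of_mulVec_eq_zero hdet ?_
  ext a
  exact congrFun hv (ρ a)

/-! ### Linear independence of the admissible minors -/

section Combinatorics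

variable {N r : ℕ}

lemma orderEmbedding_add_le (I : Fin r ↪o Fin N) (a : Fin r) : (I a : ℕ) + r ≤ N + a := by
  have key : ∀ k (h : (a : ℕ) + k < r), (I a : ℕ) + k ≤ I ⟨a + k, h⟩ := by
    intro k
    induction k with
    | zero => intro h; simp
    | succ k ih =>
      intro h
      have h1 := ih (by omega)
      have h2 : I ⟨a + k, by omega⟩ < I ⟨a + (k + 1), h⟩ := I.strictMono (by simp [Fin.lt_def])
      have h3 : (I ⟨a + k, by omega⟩ : ℕ) < I ⟨a + (k + 1), h⟩ := h2
      omega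
  have h1 := key (r - 1 - a) (by omega)
  have h2 := (I ⟨a + (r - 1 - a), by omega⟩).isLt
  omega

/-- The bound I a + r ≤ N + a forces b ≤ σ b for b ≥ d. Descending induction then fixes any larger σ
b, and injectivity gives σ b = b. -/
lemma perm_fixes_of_top (I : Fin r ↪o Fin N) (σ : Equiv.Perm (Fin r)) {d : ℕ}
    (h : ∀ b : Fin r, d ≤ (b : ℕ) → (I (σ b) : ℕ) + r = N + b) :
    ∀ b : Fin r, d ≤ (b : ℕ) → σ b = b := by
  intro b hb
  induction hk : r - (b : ℕ) using Nat.strong_induction_on generalizing b with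
  | _ k ih =>
    by_contra hne
    have h1 : (b : ℕ) ≤ σ b := by
      have := orderEmbedding_add_le I (σ b)
      have := h b hb
      omega
    have h2 : (b : ℕ) ≠ σ b := fun h' => hne (Fin.ext h'.symm)
    exact hne (σ.injective (ih (r - (σ b : ℕ)) (by omega) (σ b) (by omega) rfl))

/-- The tuples containing the last `r - d` indices, whose first `d` entries `i_0 < i_1 < ⋯` are
such that the numbers `i_b - b n` decrease weakly and are at least `l`. -/
def IsDominant (n d l : ℕ) (I : Fin r ↪o Fin N) : Prop :=
  (∀ b : Fin r, d ≤ (b : ℕ) → (I b : ℕ) + r = N + b) ∧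
  (∀ b : Fin r, (b : ℕ) < d → l + b * n ≤ (I b : ℕ)) ∧
  ∀ a b : Fin r, a ≤ b → (b : ℕ) < d → (I b : ℕ) + a * n ≤ I a + b * n

/-- The exponent of the monomial in the `(m, b)` entry of the generic matrix. -/
def entryExponent (n d b m : ℕ) : ℕ →₀ ℕ :=
  if b < d then Finsupp.single (m - b * n) 1 else 0

/-- The monomial records the multiset of the numbers i_b - bn, and dominance prescribes their order.
Padding with zeros from position d on keeps the sequence weakly decreasing, so two sorted lists with
equal multisets can be compared. -/
lemma IsDominant.eq_of_sum_entryExponent {n d l : ℕ} {I I' : Fin r ↪o Fin N}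
    (hI : IsDominant n d l I) (hI' : IsDominant n d l I')
    (h : ∑ b : Fin r, entryExponent n d b (I b) = ∑ b : Fin r, entryExponent n d b (I' b)) :
    I = I' := by
  set Φ : (ℕ →₀ ℕ) →+ Multiset ℕ :=
    (Multiset.mapAddMonoidHom (· + 1)).comp Finsupp.toMultiset with hΦ
  set Y : (Fin r ↪o Fin N) → Fin r → ℕ := fun I b =>
    if (b : ℕ) < d then (I b : ℕ) - b * n + 1 else 0 with hY
  have hYΦ : ∀ I : Fin r ↪o Fin N, (Finset.univ : Finset (Fin r)).val.map (Y I) =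
      Φ (∑ b : Fin r, entryExponent n d b (I b)) +
        ∑ b : Fin r, (if (b : ℕ) < d then 0 else {0}) := by
    intro I
    rw [map_sum, ← Finset.sum_add_distrib, ← Finset.sum_multiset_singleton,
      ← Multiset.coe_mapAddMonoidHom, map_sum]
    refine Finset.sum_congr rfl fun b _ => ?_
    by_cases hb : (b : ℕ) < d <;> simp [hΦ, hY, entryExponent, hb]
  have hanti : ∀ I : Fin r ↪o Fin N, IsDominant n d l I → Antitone (Y I) := by
    intro I hI a b hab
    have hab' : (a : ℕ) ≤ b := hab
    simp only [hY]
    by_cases hb : (b : ℕ) < d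
    · have h1 := hI.2.2 a b hab hb
      rw [if_pos hb, if_pos (by omega)]
      omega
    · rw [if_neg hb]; omega
  have hYY : Y I = Y I' := by
    apply List.ofFn_injective
    refine List.Perm.eq_of_sortedGE (hanti I hI).sortedGE_ofFn (hanti I' hI').sortedGE_ofFn ?_
    rw [← Multiset.coe_eq_coe, ← Fin.univ_val_map, ← Fin.univ_val_map, hYΦ, hYΦ, h]
  ext b
  by_cases hb : (b : ℕ) < d
  · have h1 := congrFun hYY b
    simp only [hY, if_pos hb] at h1
    have h2 := hI.2.1 b hb
    have h3 := hI'.2.1 b hb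
    omega
  · have h2 := hI.1 b (by omega)
    have h3 := hI'.1 b (by omega)
    omega

/-- Strict rearrangement inequality: equality would make σ monotone, hence the identity. -/
lemma sum_mul_comp_perm_lt (I : Fin r ↪o Fin N) {σ : Equiv.Perm (Fin r)} (hσ : σ ≠ 1) :
    ∑ b : Fin r, ((b : ℕ) : ℤ) * (I (σ b) : ℕ) < ∑ b : Fin r, ((b : ℕ) : ℤ) * (I b : ℕ) := by
  have hmono : Monovary (fun b : Fin r => ((b : ℕ) : ℤ)) (fun b => ((I b : ℕ) : ℤ)) := by
    intro a b hab
    simp only [Nat.cast_lt, Nat.cast_le] at hab ⊢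
    exact (I.lt_iff_lt.1 hab).le
  refine (hmono.sum_mul_comp_perm_lt_sum_mul_iff (σ := σ)).2 fun h => hσ ?_
  have hσm : Monotone σ := by
    intro a b hab
    by_contra hlt
    push Not at hlt
    have h1 := @h b a (by simpa using I.strictMono hlt)
    simp only [Nat.cast_le] at h1
    have : a = b := le_antisymm hab h1
    subst this
    exact lt_irrefl _ hlt
  have h1 := Tuple.unique_monotone (f := (id : Fin r → Fin r)) (σ := σ) (τ := 1)
    (by simpa using hσm) (by simpa using monotone_id)
  ext b
  simpa using congrArg Fin.val (congrFun h1 b)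

/-- Expanding (I (σ b) - bn)², the sum of the I (σ b)² does not depend on σ, so only the cross term
-2n ∑ b I (σ b) matters; rearrangement makes it smallest at the identity. Indices b ≥ d are fixed by
σ and cancel. -/
lemma IsDominant.weight_lt {n d l : ℕ} (hn : 1 ≤ n) {I : Fin r ↪o Fin N}
    (hI : IsDominant n d l I) {σ : Equiv.Perm (Fin r)} (hσ : σ ≠ 1)
    (h1 : ∀ b : Fin r, (b : ℕ) < d → b * n ≤ (I (σ b) : ℕ))
    (h2 : ∀ b : Fin r, d ≤ (b : ℕ) → (I (σ b) : ℕ) + r = N + b) :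
    Finsupp.weight (fun m : ℕ => m ^ 2) (∑ b : Fin r, entryExponent n d b (I b)) <
      Finsupp.weight (fun m : ℕ => m ^ 2) (∑ b : Fin r, entryExponent n d b (I (σ b))) := by
  have hfix := perm_fixes_of_top I σ h2
  have hw : ∀ τ : Equiv.Perm (Fin r), (∀ b : Fin r, (b : ℕ) < d → b * n ≤ (I (τ b) : ℕ)) →
      ((Finsupp.weight (fun m : ℕ => m ^ 2) (∑ b : Fin r, entryExponent n d b (I (τ b))) : ℕ) : ℤ)
        = ∑ b : Fin r, if (b : ℕ) < d then (((I (τ b) : ℕ) : ℤ) - b * n) ^ 2 else 0 := by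
    intro τ hτ
    rw [map_sum, Nat.cast_sum]
    refine Finset.sum_congr rfl fun b _ => ?_
    unfold entryExponent
    split_ifs with hb
    · rw [Finsupp.weight_single]
      rw [one_smul, Nat.cast_pow, Nat.cast_sub (hτ b hb), Nat.cast_mul]
    · simp
  have hw1 := hw 1 fun b hb => by have := hI.2.1 b hb; simp only [Equiv.Perm.one_apply]; omega
  simp only [Equiv.Perm.one_apply] at hw1
  have hlt := sum_mul_comp_perm_lt I hσ
  have hsq : ∑ b : Fin r, ((I (σ b) : ℕ) : ℤ) ^ 2 = ∑ b : Fin r, ((I b : ℕ) : ℤ) ^ 2 :=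
    Equiv.sum_comp σ fun b => ((I b : ℕ) : ℤ) ^ 2
  have hdiff : (∑ b : Fin r, if (b : ℕ) < d then (((I (σ b) : ℕ) : ℤ) - b * n) ^ 2 else 0) -
      (∑ b : Fin r, if (b : ℕ) < d then (((I b : ℕ) : ℤ) - b * n) ^ 2 else 0) =
      2 * n * (∑ b : Fin r, ((b : ℕ) : ℤ) * (I b : ℕ) -
        ∑ b : Fin r, ((b : ℕ) : ℤ) * (I (σ b) : ℕ)) := by
    have e1 : (∑ b : Fin r, if (b : ℕ) < d then (((I (σ b) : ℕ) : ℤ) - b * n) ^ 2 else 0) -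
      (∑ b : Fin r, if (b : ℕ) < d then (((I b : ℕ) : ℤ) - b * n) ^ 2 else 0) =
      ∑ b : Fin r, ((((I (σ b) : ℕ) : ℤ) - b * n) ^ 2 - (((I b : ℕ) : ℤ) - b * n) ^ 2) := by
      rw [← Finset.sum_sub_distrib]
      refine Finset.sum_congr rfl fun b _ => ?_
      split_ifs with hb
      · rfl
      · rw [hfix b (by omega)]; ring
    rw [e1, ← Finset.sum_sub_distrib, Finset.mul_sum]
    have e2 : ∀ b : Fin r, (((I (σ b) : ℕ) : ℤ) - b * n) ^ 2 - (((I b : ℕ) : ℤ) - b * n) ^ 2 =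
        (((I (σ b) : ℕ) : ℤ) ^ 2 - ((I b : ℕ) : ℤ) ^ 2) +
        2 * n * (((b : ℕ) : ℤ) * (I b : ℕ) - ((b : ℕ) : ℤ) * (I (σ b) : ℕ)) := by
      intro b; ring
    rw [Finset.sum_congr rfl fun b _ => e2 b, Finset.sum_add_distrib, Finset.sum_sub_distrib, hsq,
      sub_self, zero_add]
  have hn' : (0 : ℤ) < 2 * n := by exact_mod_cast (by omega : 0 < 2 * n)
  have := mul_pos hn' (sub_pos.2 hlt)
  rw [← hdiff, ← hw1, ← hw σ h1, sub_pos] at this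
  exact_mod_cast this

end Combinatorics

/-- The generic vector with vanishing entries in the positions below `l`. -/
def genericVector (K : Type*) [Field K] (l : ℕ) : ℕ → MvPolynomial ℕ K :=
  fun m => if l ≤ m then MvPolynomial.X m else 0

/-! ### Lowest-weight monomials in the Leibniz expansion of generic minors. -/

section Leibniz

variable {K : Type*} [Field K] {N r n d l : ℕ}

lemma prod_cyclicMatrix_genericVector (f : Fin r → Fin N) :
    ∏ b, cyclicMatrix N r n d (genericVector K l) (f b) b =
      if ∀ b : Fin r, if (b : ℕ) < d then b * n ≤ (f b : ℕ) ∧ l ≤ f b - b * n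
        else (f b : ℕ) + r = N + b
      then MvPolynomial.monomial (∑ b : Fin r, entryExponent n d b (f b)) 1 else 0 := by
  classical
  rw [MvPolynomial.monomial_sum_one]
  have h := Finset.prod_ite_zero (s := (Finset.univ : Finset (Fin r)))
    (p := fun b : Fin r => if (b : ℕ) < d then b * n ≤ (f b : ℕ) ∧ l ≤ f b - b * n
        else (f b : ℕ) + r = N + b)
    (f := fun b : Fin r => (MvPolynomial.monomial (entryExponent n d b (f b)) (1 : K)))
  simp only [Finset.mem_univ, true_imp_iff] at h
  rw [← h]
  refine Finset.prod_congr rfl fun b _ => ?_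
  unfold cyclicMatrix genericVector entryExponent
  by_cases hb : (b : ℕ) < d
  · simp only [hb, if_true]
    by_cases h1 : (b : ℕ) * n ≤ f b
    · by_cases h2 : l ≤ f b - b * n
      · simp [h1, h2, MvPolynomial.X]
      · simp [h2]
    · simp [h1]
  · simp only [hb, if_false]
    split_ifs <;> simp

/-- Each nonzero Leibniz term of I with σ ≠ 1 weighs strictly more than the diagonal term of I,
hence more than the monomial of S. Only the diagonal term can contribute, and it determines the
tuple. -/
lemma IsDominant.coeff_det (hn : 1 ≤ n) {S I : Fin r ↪o Fin N} (hS : IsDominant n d l S)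
    (hI : IsDominant n d l I)
    (hle : Finsupp.weight (fun m : ℕ => m ^ 2) (∑ b : Fin r, entryExponent n d b (S b)) ≤
      Finsupp.weight (fun m : ℕ => m ^ 2) (∑ b : Fin r, entryExponent n d b (I b))) :
    MvPolynomial.coeff (∑ b : Fin r, entryExponent n d b (S b))
      ((cyclicMatrix N r n d (genericVector K l)).submatrix I id).det =
      if I = S then 1 else 0 := by
  classical
  rw [Matrix.det_apply, MvPolynomial.coeff_sum]
  simp only [Matrix.submatrix_apply, id]
  have hterm : ∀ σ : Equiv.Perm (Fin r), σ ≠ 1 →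
      MvPolynomial.coeff (∑ b : Fin r, entryExponent n d b (S b))
        (Equiv.Perm.sign σ • ∏ b, cyclicMatrix N r n d (genericVector K l) (I (σ b)) b) = 0 := by
    intro σ hσ
    rw [prod_cyclicMatrix_genericVector (fun b => I (σ b))]
    split_ifs with hv
    · rw [Units.smul_def, ← Int.cast_smul_eq_zsmul K, MvPolynomial.coeff_smul,
        MvPolynomial.coeff_monomial, if_neg, smul_zero]
      intro heq
      have := hI.weight_lt hn hσ
        (fun b hb => by have := hv b; rw [if_pos hb] at this; exact this.1)
        (fun b hb => by have := hv b; rw [if_neg (by omega)] at this; exact this)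
      rw [heq] at this
      omega
    · simp
  rw [Finset.sum_eq_single 1 (fun σ _ hσ => hterm σ hσ) (by simp)]
  simp only [Equiv.Perm.sign_one, one_smul, Equiv.Perm.one_apply]
  rw [prod_cyclicMatrix_genericVector (fun b => I b), if_pos, MvPolynomial.coeff_monomial]
  · by_cases hIS : I = S
    · subst hIS; simp
    · rw [if_neg hIS, if_neg fun h => hIS (hI.eq_of_sum_entryExponent hS h)]
  · intro b
    split_ifs with hb
    · have := hI.2.1 b hb
      omega
    · exact hI.1 b (by omega)

end Leibniz

theorem eq_zero_of_sum_dominant_eq_zero {K : Type*} [Field K] [Infinite K] {n s d l : ℕ}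
    (hn : 1 ≤ n) (c : Tuple n s → K) (hc : ∀ S, c S ≠ 0 → IsDominant n d l S)
    (h : ∀ x : ℕ → K, (∀ m < l, x m = 0) → x l ≠ 0 →
      ∑ S, c S * pluckerVector K (cyclicMatrix (s * n * n) (s * n) n d x) S = 0) :
    c = 0 := by
  classical
  set P : MvPolynomial ℕ K := ∑ S : Tuple n s, MvPolynomial.C (c S) *
    ((cyclicMatrix (s * n * n) (s * n) n d (genericVector K l)).submatrix S id).det with hP
  have hP0 : P = 0 := by
    -- The vanishing is known only where x l ≠ 0; the factor X_l covers the remaining points.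
    have h1 : MvPolynomial.X l * P = 0 := by
      apply MvPolynomial.funext
      intro z
      rw [map_mul, MvPolynomial.eval_X, map_zero]
      by_cases hz : z l = 0
      · rw [hz, zero_mul]
      · rw [hP, map_sum]
        convert mul_zero _
        rw [← h (fun m => if l ≤ m then z m else 0) (fun m hm => if_neg (by omega))
          (by simpa using hz)]
        refine Finset.sum_congr rfl fun S _ => ?_
        rw [map_mul, MvPolynomial.eval_C, RingHom.map_det]
        unfold pluckerVector
        congr 2
        ext a b
        simp only [RingHom.mapMatrix_apply, Matrix.map_apply, Matrix.submatrix_apply, id,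
          cyclicMatrix, genericVector]
        split_ifs <;> simp
    exact (mul_eq_zero.1 h1).resolve_left (MvPolynomial.X_ne_zero l)
  set w : Tuple n s → ℕ := fun S =>
    Finsupp.weight (fun m : ℕ => m ^ 2) (∑ b : Fin (s * n), entryExponent n d b (S b)) with hw
  -- Triangularity: compare coefficients at the diagonal monomial of S, after the tuples of smaller
  -- weight have been eliminated.
  have key : ∀ q, ∀ S, w S = q → c S = 0 := by
    intro q
    induction q using Nat.strong_induction_on with
    | _ q ih =>
      intro S hq
      by_contra hcS
      have h1 := congrArg (MvPolynomial.coeff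
        (∑ b : Fin (s * n), entryExponent n d b (S b))) hP0
      rw [hP, MvPolynomial.coeff_sum, MvPolynomial.coeff_zero, Finset.sum_eq_single S] at h1
      · rw [MvPolynomial.coeff_C_mul, (hc S hcS).coeff_det hn (hc S hcS) le_rfl, if_pos rfl,
          mul_one] at h1
        exact hcS h1
      · intro I _ hIS
        rw [MvPolynomial.coeff_C_mul]
        by_cases hcI : c I = 0
        · rw [hcI, zero_mul]
        · by_cases hlt : w I < q
          · exact absurd (ih _ hlt I rfl) hcI
          · rw [(hc S hcS).coeff_det hn (hc I hcI) (by simp only [hw] at hlt hq; omega),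
              if_neg hIS, mul_zero]
      · simp
  funext S
  exact key _ S rfl

/-- An admissible tuple whose Plücker coordinate does not vanish on a cyclic matrix is
dominant. -/
lemma isDominant_of_isAdmissible {K : Type*} [Field K] {n s d l : ℕ} {x : ℕ → K}
    (hx : ∀ m < l, x m = 0) {S : Tuple n s} (hS : IsAdmissible S)
    (h : pluckerVector K (cyclicMatrix (s * n * n) (s * n) n d x) S ≠ 0) :
    IsDominant n d l S := by
  unfold pluckerVector at h
  rw [Matrix.det_apply] at h
  obtain ⟨σ, -, hσ⟩ := Finset.exists_ne_zero_of_sum_ne_zero h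
  have hprod : ∏ b, cyclicMatrix (s * n * n) (s * n) n d x (S (σ b)) b ≠ 0 := by
    intro h0
    apply hσ
    simp only [Matrix.submatrix_apply, id]
    rw [h0, smul_zero]
  rw [Finset.prod_ne_zero_iff] at hprod
  have h1 : ∀ b : Fin (s * n), d ≤ (b : ℕ) → (S (σ b) : ℕ) + s * n = s * n * n + b := by
    intro b hb
    have := hprod b (Finset.mem_univ _)
    simp only [cyclicMatrix, if_neg (Nat.not_lt.2 hb)] at this
    by_contra hne
    exact this (if_neg hne)
  have h2 : ∀ b : Fin (s * n), (b : ℕ) < d → l + b * n ≤ (S (σ b) : ℕ) := by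
    intro b hb
    have := hprod b (Finset.mem_univ _)
    simp only [cyclicMatrix, if_pos hb] at this
    by_contra hne
    apply this
    split_ifs with h3
    · exact hx _ (by omega)
    · rfl
  have hfix := perm_fixes_of_top S σ h1
  have hadm : ∀ k (a b : Fin (s * n)), (a : ℕ) + k = b → (S b : ℕ) + a * n ≤ S a + b * n := by
    intro k
    induction k with
    | zero =>
      intro a b hab
      obtain rfl : a = b := Fin.ext (by omega)
      exact le_rfl
    | succ k ih =>
      intro a b hab
      have h3 := ih a ⟨a + k, by omega⟩ rfl
      have h4 := hS (a + k)
      have h5 : (a : ℕ) + k < s * n := by omega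
      have h6 : (a : ℕ) + k + 1 < s * n := by omega
      simp only [fullSequence, h5, h6, dif_pos] at h4
      have h7 : (⟨(a : ℕ) + k + 1, h6⟩ : Fin (s * n)) = b := Fin.ext (by simp; omega)
      rw [h7] at h4
      have h8 : (b : ℕ) * n = (a + k) * n + n := by rw [← hab]; ring
      simp only at h3
      omega
  refine ⟨fun b hb => ?_, fun b hb => ?_, fun a b hab _ => hadm (b - a) a b ?_⟩
  · have := h1 b hb
    rwa [hfix b hb] at this
  -- As σ preserves the indices below d, the largest of them, e, satisfies S e ≥ S (σ e) ≥ l + en.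
  -- Admissibility carries this bound down to every b ≤ e.
  · have hdlt : ∀ a : Fin (s * n), (a : ℕ) < d → (σ a : ℕ) < d := by
      intro a ha
      by_contra hcon
      have := σ.injective (hfix (σ a) (by omega))
      rw [this] at hcon
      omega
    obtain ⟨e, he1, he2⟩ : ∃ e : Fin (s * n), (e : ℕ) < d ∧ ∀ a : Fin (s * n), (a : ℕ) < d →
        a ≤ e := by
      refine ⟨⟨min (d - 1) (s * n - 1), by omega⟩, by simp; omega, fun a ha => ?_⟩
      rw [Fin.le_def]; simp; omega
    have h3 := h2 e he1
    have h4 : (S (σ e) : ℕ) ≤ S e := S.monotone (he2 _ (hdlt e he1))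
    have h5 := hadm (e - b) b e (by have : (b : ℕ) ≤ e := he2 b hb; omega)
    omega
  · have : (a : ℕ) ≤ b := hab
    omega

section Cells

/-! ### The Schubert cells in terms of cyclic matrices -/

variable (K : Type*) [Field K]

section

variable {K} {n : ℕ}

/-- The coordinate subspace of the vectors supported in the positions `≥ a`. -/
abbrev tailSubspace (K : Type*) [Field K] (n : ℕ) (a : ℤ) : Submodule K (Fin n → K⸨X⸩) :=
  coordSubspace K n {m | a < m}

lemma mem_tailSubspace {a : ℤ} {v : Fin n → K⸨X⸩} :
    v ∈ tailSubspace K n a ↔ ∀ (c : ℤ) (i : Fin n), c * n + ((i : ℕ) : ℤ) < a →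
      (v i).coeff c = 0 := by
  change (∀ (c : ℤ) (i : Fin n), c * n + ((i : ℕ) : ℤ) + 1 ∉ {m : ℤ | a < m} → _) ↔ _
  refine forall_congr' fun c => forall_congr' fun i => ?_
  rw [Set.mem_ofPred_eq, not_lt]
  rfl

lemma act_apply (g : GL (Fin n) K⟦X⟧) (v : Fin n → K⸨X⸩) (i : Fin n) :
    act K n g v i = ∑ j, HahnSeries.ofPowerSeries ℤ K ((g : Matrix _ _ K⟦X⟧) i j) * v j := rfl

/-- A positive power of t raises positions by at least n, which outweighs any change of component.
The constant terms of g are lower triangular and never lower a position. -/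
lemma act_mem_tailSubspace {g : GL (Fin n) K⟦X⟧} (hg : g ∈ iwahori K n) {a : ℤ}
    {v : Fin n → K⸨X⸩} (hv : v ∈ tailSubspace K n a) : act K n g v ∈ tailSubspace K n a := by
  rw [mem_tailSubspace] at hv ⊢
  intro c i hci
  rw [act_apply, HahnSeries.coeff_sum]
  refine Finset.sum_eq_zero fun j _ => ?_
  rw [HahnSeries.coeff_mul]
  refine Finset.sum_eq_zero fun q hq => ?_
  have hq' : q.1 + q.2 = c := by simpa using (Finset.mem_antidiagonal.1 hq).2.2
  by_contra hne
  have h1 := left_ne_zero_of_mul hne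
  have h2 := right_ne_zero_of_mul hne
  rw [PowerSeries.coeff_coe] at h1
  have h3 : a ≤ q.2 * n + ((j : ℕ) : ℤ) := by
    by_contra h; exact h2 (hv _ _ (not_le.1 h))
  have hi := i.isLt
  have hj : ((j : ℕ) : ℤ) < n := by exact_mod_cast j.isLt
  split_ifs at h1 with h4
  · exact h1 rfl
  · rcases (not_lt.1 h4).eq_or_lt with h5 | h5
    · by_cases hij : i < j
      · apply h1
        rw [← h5]
        simpa using hg i j hij
      · have : (j : ℕ) ≤ i := not_lt.1 hij
        rw [← h5, zero_add] at hq'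
        subst hq'
        omega
    · nlinarith

/-- Reduce modulo t: the inverse of an invertible lower triangular matrix is lower triangular. -/
lemma inv_mem_iwahori {g : GL (Fin n) K⟦X⟧} (hg : g ∈ iwahori K n) : g⁻¹ ∈ iwahori K n := by
  intro i j hij
  set h := Matrix.GeneralLinearGroup.map (n := Fin n) (PowerSeries.constantCoeff (R := K)) g with hh
  have h1 : (h : Matrix (Fin n) (Fin n) K).IsLowerTriangular := by
    intro a b hab
    exact hg a b (by simpa using hab)
  have h2 : ((h⁻¹ : GL (Fin n) K) : Matrix (Fin n) (Fin n) K).IsLowerTriangular := by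
    rw [Matrix.coe_units_inv]
    have : Invertible (h : Matrix (Fin n) (Fin n) K) := h.invertible
    exact Matrix.blockTriangular_inv_of_blockTriangular h1
  have h3 : (h⁻¹ : GL (Fin n) K) =
      Matrix.GeneralLinearGroup.map (PowerSeries.constantCoeff (R := K)) g⁻¹ := by
    rw [hh, map_inv]
  have h4 := h2 (i := i) (j := j) (by simpa using hij)
  rw [h3] at h4
  exact h4

lemma act_act_inv (g : GL (Fin n) K⟦X⟧) (v : Fin n → K⸨X⸩) : act K n g (act K n g⁻¹ v) = v := by
  change ((g : Matrix (Fin n) (Fin n) K⟦X⟧).map (HahnSeries.ofPowerSeries ℤ K)).mulVec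
    (((g⁻¹ : GL (Fin n) K⟦X⟧) : Matrix (Fin n) (Fin n) K⟦X⟧).map
      (HahnSeries.ofPowerSeries ℤ K) |>.mulVec v) = v
  rw [Matrix.mulVec_mulVec, ← Matrix.map_mul, ← Units.val_mul, mul_inv_cancel, Units.val_one,
    Matrix.map_one _ (map_zero _) (map_one _), Matrix.one_mulVec]

end

/-- The coefficient of a vector of `F^n` along `e_{m+1}`. -/
def coord {n : ℕ} [NeZero n] (v : Fin n → K⸨X⸩) (m : ℕ) : K :=
  (v (Fin.ofNat n m)).coeff ((m / n : ℕ) : ℤ)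

/-- The vector `e_{m+1}` of `F^n`. -/
def basisVec (n : ℕ) [NeZero n] (m : ℕ) : Fin n → K⸨X⸩ :=
  Pi.single (Fin.ofNat n m) (HahnSeries.single ((m / n : ℕ) : ℤ) 1)

section

variable {K} {n : ℕ} [NeZero n]

lemma eq_iff_ofNat_and_div (c : ℤ) (i : Fin n) (m : ℕ) :
    c * n + ((i : ℕ) : ℤ) = m ↔ i = Fin.ofNat n m ∧ c = ((m / n : ℕ) : ℤ) := by
  have hn : 0 < n := Nat.pos_of_ne_zero (NeZero.ne n)
  have hi := i.isLt
  constructor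
  · intro h
    have hc : 0 ≤ c := by
      by_contra hneg
      push Not at hneg
      nlinarith
    lift c to ℕ using hc
    have h' : c * n + (i : ℕ) = m := by exact_mod_cast h
    subst h'
    refine ⟨Fin.ext ?_, ?_⟩
    · simp [Fin.ofNat, Nat.mod_eq_of_lt hi]
    · rw [add_comm, Nat.add_mul_div_right _ _ hn, Nat.div_eq_of_lt hi, zero_add]
  · rintro ⟨h1, h2⟩
    have h1' : (i : ℕ) = m % n := by rw [h1]; rfl
    rw [h1', h2]
    exact_mod_cast Nat.div_add_mod' m n

lemma coeff_basisVec (m : ℕ) (c : ℤ) (i : Fin n) :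
    (basisVec K n m i).coeff c = if c * n + ((i : ℕ) : ℤ) = m then 1 else 0 := by
  unfold basisVec
  by_cases h1 : i = Fin.ofNat n m
  · by_cases h2 : c = ((m / n : ℕ) : ℤ)
    · rw [if_pos ((eq_iff_ofNat_and_div c i m).2 ⟨h1, h2⟩), h1, h2, Pi.single_eq_same,
        HahnSeries.coeff_single_same]
    · rw [if_neg fun h => h2 ((eq_iff_ofNat_and_div c i m).1 h).2, h1, Pi.single_eq_same,
        HahnSeries.coeff_single_of_ne h2]
  · rw [Pi.single_eq_of_ne h1, if_neg, HahnSeries.coeff_zero]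
    exact fun h => h1 ((eq_iff_ofNat_and_div c i m).1 h).1

lemma coeff_eq_coord (v : Fin n → K⸨X⸩) {c : ℤ} {i : Fin n} {m : ℕ}
    (h : c * n + ((i : ℕ) : ℤ) = m) : (v i).coeff c = coord K v m := by
  obtain ⟨rfl, rfl⟩ := (eq_iff_ofNat_and_div c i m).1 h
  rfl

lemma trunc_apply {s : ℕ} (v : Fin n → K⸨X⸩) (m : Fin (s * n * n)) :
    trunc K n s v m = coord K v m := by
  change (v (finProdFinEquiv.symm m).2).coeff ((finProdFinEquiv.symm m).1 : ℕ) = _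
  apply coeff_eq_coord
  have h : ((m / n : ℕ) : ℤ) * n + ((m % n : ℕ) : ℤ) = (m : ℕ) := by
    exact_mod_cast Nat.div_add_mod' m n
  exact h

lemma coord_basisVec (a m : ℕ) : coord K (basisVec K n a) m = if m = a then 1 else 0 := by
  unfold coord
  rw [coeff_basisVec, (eq_iff_ofNat_and_div _ _ m).2 ⟨rfl, rfl⟩]
  simp

/-- The coefficients of `g e_{l+1}`. -/
def columnVec (g : GL (Fin n) K⟦X⟧) (l m : ℕ) : K :=
  if l / n ≤ m / n then
    PowerSeries.coeff (m / n - l / n) ((g : Matrix _ _ K⟦X⟧) (Fin.ofNat n m) (Fin.ofNat n l))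
  else 0

lemma columnVec_eq_zero {g : GL (Fin n) K⟦X⟧} (hg : g ∈ iwahori K n) {l m : ℕ} (h : m < l) :
    columnVec g l m = 0 := by
  unfold columnVec
  split_ifs with h1
  · have h2 : m / n = l / n := le_antisymm (Nat.div_le_div_right h.le) h1
    have h3 : m % n < l % n := by
      have e1 := Nat.div_add_mod m n
      have e2 := Nat.div_add_mod l n
      rw [h2] at e1
      omega
    rw [h2, Nat.sub_self, PowerSeries.coeff_zero_eq_constantCoeff]
    exact hg _ _ h3
  · rfl

lemma columnVec_self_ne_zero {g : GL (Fin n) K⟦X⟧} (hg : g ∈ iwahori K n) (l : ℕ) :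
    columnVec g l l ≠ 0 := by
  unfold columnVec
  rw [if_pos le_rfl, Nat.sub_self, PowerSeries.coeff_zero_eq_constantCoeff]
  set h := Matrix.GeneralLinearGroup.map (n := Fin n) (PowerSeries.constantCoeff (R := K)) g with hh
  have h1 : (h : Matrix (Fin n) (Fin n) K).IsLowerTriangular := by
    intro a b hab
    exact hg a b (by simpa using hab)
  have h2 : (h : Matrix (Fin n) (Fin n) K).det ≠ 0 :=
    ((Matrix.isUnit_iff_isUnit_det _).1 h.isUnit).ne_zero
  rw [Matrix.det_of_isLowerTriangular _ h1, Finset.prod_ne_zero_iff] at h2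
  exact h2 (Fin.ofNat n l) (Finset.mem_univ _)

/-- Take the identity matrix with the column of index l mod n replaced by the series with
coefficients x. Its determinant is the diagonal entry of that column, with constant term x l, so it
is a unit. -/
lemma exists_columnVec_eq {l : ℕ} {x : ℕ → K} (hx : ∀ m < l, x m = 0) (hl : x l ≠ 0) :
    ∃ g ∈ iwahori K n, columnVec g l = x := by
  have hn : 0 < n := Nat.pos_of_ne_zero (NeZero.ne n)
  set j := Fin.ofNat n l with hj
  set u : Fin n → K⟦X⟧ := fun i => PowerSeries.mk fun c => x ((c + l / n) * n + i) with hu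
  have hdet : ((1 : Matrix (Fin n) (Fin n) K⟦X⟧).updateCol j u).det = u j := by
    rw [← Matrix.cramer_apply, Matrix.cramer_one]; rfl
  have hunit : IsUnit ((1 : Matrix (Fin n) (Fin n) K⟦X⟧).updateCol j u).det := by
    rw [hdet, PowerSeries.isUnit_iff_constantCoeff, isUnit_iff_ne_zero]
    have : l / n * n + l % n = l := Nat.div_add_mod' l n
    simpa [hu, hj, Fin.ofNat, this] using hl
  refine ⟨Matrix.GeneralLinearGroup.mk'' _ hunit, fun i k hik => ?_, ?_⟩
  · change PowerSeries.constantCoeff ((1 : Matrix (Fin n) (Fin n) K⟦X⟧).updateCol j u i k) = 0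
    by_cases hk : k = j
    · subst hk
      rw [Matrix.updateCol_self]
      have h1 : (i : ℕ) < l % n := hik
      have h2 : x (l / n * n + i) = 0 := hx _ (by have := Nat.div_add_mod' l n; omega)
      simpa [hu] using h2
    · rw [Matrix.updateCol_ne hk, Matrix.one_apply_ne hik.ne, map_zero]
  · funext m
    unfold columnVec
    change (if l / n ≤ m / n then PowerSeries.coeff (m / n - l / n)
      ((1 : Matrix (Fin n) (Fin n) K⟦X⟧).updateCol j u (Fin.ofNat n m) j) else 0) = x m
    split_ifs with h
    · rw [Matrix.updateCol_self, hu, PowerSeries.coeff_mk, Nat.sub_add_cancel h]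
      congr 1
      exact Nat.div_add_mod' m n
    · rw [hx]
      by_contra hcon
      exact h (Nat.div_le_div_right (not_lt.1 hcon))

lemma trunc_act_basisVec {s d : ℕ} (g : GL (Fin n) K⟦X⟧) (l : ℕ) (b : Fin (s * n))
    (hb : (b : ℕ) < d) (m : Fin (s * n * n)) :
    trunc K n s (act K n g (basisVec K n (l + b * n))) m =
      cyclicMatrix (s * n * n) (s * n) n d (columnVec g l) m b := by
  have hn : 0 < n := Nat.pos_of_ne_zero (NeZero.ne n)
  rw [trunc_apply, coord, act_apply, Finset.sum_eq_single (Fin.ofNat n l)]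
  · have e1 : basisVec K n (l + b * n) (Fin.ofNat n l) =
        HahnSeries.single ((l / n + b : ℕ) : ℤ) 1 := by
      unfold basisVec
      have : Fin.ofNat n (l + b * n) = Fin.ofNat n l := by
        apply Fin.ext; simp [Fin.ofNat]
      rw [this, Pi.single_eq_same, Nat.add_mul_div_right _ _ hn]
    rw [e1, HahnSeries.coeff_mul_single, mul_one, PowerSeries.coeff_coe]
    simp only [cyclicMatrix, if_pos hb, columnVec]
    by_cases h1 : (b : ℕ) * n ≤ m
    · have h2 : (b : ℕ) ≤ m / n := (Nat.le_div_iff_mul_le hn).2 h1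
      have h3 : ((m : ℕ) - b * n) / n = m / n - b := by
        have := Nat.sub_mul_div (m : ℕ) n b
        rwa [mul_comm n (b : ℕ)] at this
      have h4 : Fin.ofNat n ((m : ℕ) - b * n) = Fin.ofNat n m := by
        apply Fin.ext
        have := Nat.sub_mul_mod (x := (m : ℕ)) (k := b) (n := n) (by rwa [mul_comm])
        rwa [mul_comm n (b : ℕ)] at this
      rw [if_pos h1, h3, h4]
      generalize (m : ℕ) / n = p at h2
      generalize l / n = q
      by_cases h5 : q ≤ p - b
      · have h6 : ¬ (p : ℤ) - ((q + b : ℕ) : ℤ) < 0 := by omega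
        have h7 : ((p : ℤ) - ((q + b : ℕ) : ℤ)).natAbs = p - b - q := by omega
        rw [if_pos h5, if_neg h6, h7]
      · have h6 : (p : ℤ) - ((q + b : ℕ) : ℤ) < 0 := by omega
        rw [if_neg h5, if_pos h6]
    · have h2 : ¬ (b : ℕ) ≤ m / n := fun h => h1 ((Nat.le_div_iff_mul_le hn).1 h)
      rw [if_neg h1]
      generalize (m : ℕ) / n = p at h2
      generalize l / n = q
      have h6 : (p : ℤ) - ((q + b : ℕ) : ℤ) < 0 := by omega
      rw [if_pos h6]
  · intro j _ hj
    unfold basisVec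
    rw [Pi.single_eq_of_ne, mul_zero]
    intro h
    apply hj
    rw [h]
    apply Fin.ext; simp [Fin.ofNat]
  · simp

/-- The lattice is the sum of the span of e_{l+1}, t e_{l+1}, …, t^{d-1} e_{l+1} and a tail that
absorbs the later terms by `h2`. The element g sends the first part to the first d columns and maps
the tail onto itself; its truncation is spanned by the last r - d basis vectors. -/
lemma map_act_map_trunc {s d l : ℕ} {I : Set ℤ} {g : GL (Fin n) K⟦X⟧} (hg : g ∈ iwahori K n)
    (hd : d ≤ s * n)
    (h2 : s * n * n + d ≤ l + d * n + s * n)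
    (hI : ∀ m : ℤ, m ∈ I ↔ ((l : ℤ) + 1 ≤ m ∧ (n : ℤ) ∣ m - (l + 1)) ∨
      ((s * n * n + d : ℕ) : ℤ) - (s * n : ℕ) < m) :
    ((coordSubspace K n I).map (act K n g)).map (trunc K n s) =
      LinearMap.range (cyclicMatrix (s * n * n) (s * n) n d (columnVec g l)).mulVecLin := by
  have hn : 0 < n := Nat.pos_of_ne_zero (NeZero.ne n)
  have hrN : s * n ≤ s * n * n := Nat.le_mul_of_pos_right _ hn
  set a : ℤ := ((s * n * n + d : ℕ) : ℤ) - (s * n : ℕ) with ha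
  set M := cyclicMatrix (s * n * n) (s * n) n d (columnVec g l) with hM
  have htail : tailSubspace K n a ≤ coordSubspace K n I := by
    intro v hv c i hci
    refine mem_tailSubspace.1 hv c i ?_
    by_contra hcon
    exact hci ((hI _).2 (Or.inr (by omega)))
  have hcol1 : ∀ b : Fin (s * n), (b : ℕ) < d →
      trunc K n s (act K n g (basisVec K n (l + b * n))) = M.col b := by
    intro b hb
    ext m
    exact trunc_act_basisVec g l b hb m
  have hcol2 : ∀ b : Fin (s * n), d ≤ (b : ℕ) →
      trunc K n s (basisVec K n (s * n * n + b - s * n)) = M.col b := by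
    intro b hb
    ext m
    rw [trunc_apply, coord_basisVec]
    simp only [hM, Matrix.col_apply, cyclicMatrix]
    rw [if_neg (by omega : ¬ (b : ℕ) < d)]
    refine if_congr ?_ rfl rfl
    omega
  rw [Matrix.range_mulVecLin]
  apply le_antisymm
  · rintro _ ⟨_, ⟨w, hw, rfl⟩, rfl⟩
    set w₀ : Fin n → K⸨X⸩ :=
      ∑ k : Fin d, coord K w (l + k * n) • basisVec K n (l + k * n) with hw₀
    have hdiff : w - w₀ ∈ tailSubspace K n a := by
      rw [mem_tailSubspace]
      intro c i hci
      have hcoeff : (w₀ i).coeff c = ∑ k : Fin d, coord K w (l + k * n) *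
          (if c * n + ((i : ℕ) : ℤ) = ((l + k * n : ℕ) : ℤ) then 1 else 0) := by
        rw [hw₀, Finset.sum_apply, HahnSeries.coeff_sum]
        refine Finset.sum_congr rfl fun k _ => ?_
        rw [Pi.smul_apply, HahnSeries.coeff_smul, coeff_basisVec, smul_eq_mul]
      rw [Pi.sub_apply, HahnSeries.coeff_sub, hcoeff]
      by_cases hk : ∃ k : Fin d, c * n + ((i : ℕ) : ℤ) = ((l + k * n : ℕ) : ℤ)
      · obtain ⟨k, hk⟩ := hk
        rw [Finset.sum_eq_single k, if_pos hk, mul_one, coeff_eq_coord w hk, sub_self]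
        · intro k' _ hkk
          rw [if_neg, mul_zero]
          intro h
          rw [hk] at h
          have h3 : l + (k : ℕ) * n = l + k' * n := by exact_mod_cast h
          exact hkk (Fin.ext (Nat.eq_of_mul_eq_mul_right hn (by omega)))
        · simp
      · push Not at hk
        rw [Finset.sum_eq_zero (fun k _ => by rw [if_neg (hk k), mul_zero]), sub_zero]
        apply hw
        rw [hI]
        rintro (⟨h3, q, hq⟩ | h3)
        · have hq0 : 0 ≤ q := by
            by_contra hneg
            push Not at hneg
            have : (0 : ℤ) < n := by exact_mod_cast hn
            nlinarith
          lift q to ℕ using hq0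
          have e : c * n + ((i : ℕ) : ℤ) = ((l + q * n : ℕ) : ℤ) := by push_cast; linarith
          refine hk ⟨q, ?_⟩ e
          by_contra hqd
          push Not at hqd
          have := Nat.mul_le_mul_right n hqd
          omega
        · omega
    have hsplit : trunc K n s (act K n g w) =
        trunc K n s (act K n g (w - w₀)) +
          ∑ k : Fin d, coord K w (l + k * n) •
            trunc K n s (act K n g (basisVec K n (l + k * n))) := by
      rw [map_sub, map_sub, hw₀]
      simp only [map_sum, map_smul]
      rw [sub_add_cancel]
    rw [hsplit]
    refine Submodule.add_mem _ ?_ (Submodule.sum_mem _ fun k _ => Submodule.smul_mem _ _ ?_)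
    · have hmem := mem_tailSubspace.1 (act_mem_tailSubspace hg hdiff)
      set v := act K n g (w - w₀)
      have e : trunc K n s v = ∑ b : Fin (s * n),
          (if d ≤ (b : ℕ) then coord K v (s * n * n + b - s * n) else 0) • M.col b := by
        ext m
        rw [Finset.sum_apply, trunc_apply]
        by_cases hm : s * n * n + d ≤ (m : ℕ) + s * n
        · rw [Finset.sum_eq_single ⟨m + s * n - s * n * n, by omega⟩]
          · rw [if_pos (by simp; omega), ← hcol2 _ (by simp; omega), Pi.smul_apply, trunc_apply,
              coord_basisVec, if_pos (by simp; omega), smul_eq_mul, mul_one]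
            congr 1
            simp; omega
          · intro b _ hb
            by_cases hbd : d ≤ (b : ℕ)
            · rw [Pi.smul_apply, ← hcol2 b hbd, trunc_apply, coord_basisVec,
                if_neg (α := K) (c := (m : ℕ) = s * n * n + b - s * n), smul_zero]
              intro h
              exact hb (Fin.ext (by simp; omega))
            · rw [if_neg hbd, zero_smul]; rfl
          · simp
        · rw [Finset.sum_eq_zero]
          · refine hmem _ _ ?_
            rw [(eq_iff_ofNat_and_div _ _ (m : ℕ)).2 ⟨rfl, rfl⟩]
            omega
          · intro b _
            by_cases hbd : d ≤ (b : ℕ)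
            · rw [Pi.smul_apply, ← hcol2 b hbd, trunc_apply, coord_basisVec,
                if_neg (α := K) (c := (m : ℕ) = s * n * n + b - s * n), smul_zero]
              omega
            · rw [if_neg hbd, zero_smul]; rfl
      rw [e]
      exact Submodule.sum_mem _ fun b _ => Submodule.smul_mem _ _
        (Submodule.subset_span ⟨b, rfl⟩)
    · exact Submodule.subset_span ⟨⟨k, by omega⟩, (hcol1 ⟨k, by omega⟩ k.isLt).symm⟩
  · rw [Submodule.span_le]
    rintro _ ⟨b, rfl⟩
    by_cases hb : (b : ℕ) < d
    · rw [← hcol1 b hb]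
      refine ⟨_, ⟨basisVec K n (l + b * n), ?_, rfl⟩, rfl⟩
      intro c i hci
      rw [coeff_basisVec, if_neg]
      intro h
      apply hci
      rw [h, hI]
      left
      push_cast
      exact ⟨by nlinarith, ⟨b, by ring⟩⟩
    · rw [← hcol2 b (not_lt.1 hb)]
      -- The tail is also stable under g⁻¹, so each of its vectors is the image under g of a vector
      -- of the lattice.
      refine ⟨_, ⟨act K n g⁻¹ (basisVec K n (s * n * n + b - s * n)), htail
        (act_mem_tailSubspace (inv_mem_iwahori hg) ?_), rfl⟩, ?_⟩
      · rw [mem_tailSubspace]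
        intro c i hci
        rw [coeff_basisVec, if_neg]
        omega
      · rw [act_act_inv]

end

/-- The Schubert cell of `τ_ℓ` consists of the column spaces of the cyclic matrices of the vectors
with leading position `ℓ - 1`. -/
theorem exists_mem_cell_iff {n : ℕ} (hn : 1 ≤ n) (s l : ℕ) (h1 : 1 ≤ l)
    (hl : l ≤ s * n * (n - 1) + 1) :
    ∃ d : ℕ, d ≤ s * n ∧ (∀ k < d, (l - 1) + k * n + s * n < s * n * n + d) ∧
      s * n * n + d ≤ (l - 1) + d * n + s * n ∧
      ∀ U, U ∈ cell K n s l ↔ ∃ x : ℕ → K, (∀ m < l - 1, x m = 0) ∧ x (l - 1) ≠ 0 ∧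
        U = LinearMap.range (cyclicMatrix (s * n * n) (s * n) n d x).mulVecLin := by
  have : NeZero n := ⟨by omega⟩
  obtain ⟨d, hd, ha, hb, hI⟩ := exists_mem_indexSet_iff hn s l h1 hl
  have hT : s * n * (n - 1) + s * n = s * n * n := by
    obtain ⟨q, rfl⟩ : ∃ q, n = q + 1 := ⟨n - 1, by omega⟩
    simp only [Nat.add_sub_cancel]; ring
  have hk : ∀ k < d, (l - 1) + k * n + s * n < s * n * n + d := by
    intro k hk
    have : (k : ℤ) * n ≤ ((d : ℤ) - 1) * n :=
      mul_le_mul_of_nonneg_right (by omega) (by positivity)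
    have e : ((k * n : ℕ) : ℤ) = (k : ℤ) * n := by push_cast; ring
    omega
  have hd2 : s * n * n + d ≤ (l - 1) + d * n + s * n := by
    have e : ((d * n : ℕ) : ℤ) = (d : ℤ) * n := by push_cast; ring
    omega
  have hI' : ∀ m : ℤ, m ∈ indexSet n s l ↔
      (((l - 1 : ℕ) : ℤ) + 1 ≤ m ∧ (n : ℤ) ∣ m - (((l - 1 : ℕ) : ℤ) + 1)) ∨
      ((s * n * n + d : ℕ) : ℤ) - (s * n : ℕ) < m := by
    intro m
    rw [hI, show ((l - 1 : ℕ) : ℤ) + 1 = l by omega,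
      show ((s * n * n + d : ℕ) : ℤ) - (s * n : ℕ) = ((s * n * (n - 1) + d : ℕ) : ℤ) by omega]
  refine ⟨d, hd, hk, hd2, fun U => ⟨?_, ?_⟩⟩
  · rintro ⟨_, ⟨g, hg, rfl⟩, rfl⟩
    exact ⟨columnVec g (l - 1), fun m hm => columnVec_eq_zero hg hm,
      columnVec_self_ne_zero hg _, map_act_map_trunc hg hd hd2 hI'⟩
  · rintro ⟨x, hx, hxl, rfl⟩
    obtain ⟨g, hg, rfl⟩ := exists_columnVec_eq (n := n) hx hxl
    exact ⟨_, ⟨g, hg, rfl⟩, map_act_map_trunc hg hd hd2 hI'⟩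

end Cells

section LinearForms

/-! ### Linear forms in the Plücker coordinates -/

variable {K : Type*} [Field K] {n s : ℕ}

/-- The class in `K[Gr(r, V_s)]` of a linear form in the Plücker coordinates. -/
def linearForm : (Tuple n s → K) →ₗ[K] CoordRing K n s :=
  ∑ I : Tuple n s, (LinearMap.proj I : (Tuple n s → K) →ₗ[K] K).smulRight (p K I)

lemma linearForm_apply (c : Tuple n s → K) : linearForm c = ∑ I, c I • p K I := by
  simp [linearForm, LinearMap.sum_apply]

lemma linearForm_eq_mk (c : Tuple n s → K) :
    linearForm c = Ideal.Quotient.mk (grassmannianIdeal K n s)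
      (∑ I, c I • MvPolynomial.X I) := by
  rw [linearForm_apply, map_sum]
  rfl

lemma linearForm_single (I : Tuple n s) [DecidableEq (Tuple n s)] :
    linearForm (Pi.single I (1 : K)) = p K I := by
  rw [linearForm_apply, Finset.sum_eq_single I]
  · simp
  · intro J _ hJ
    rw [Pi.single_eq_of_ne hJ, zero_smul]
  · simp

lemma mk_mem_idealOf_iff {X : Set (Submodule K (Fin (s * n * n) → K))}
    (hX : X ⊆ grassmannian K n s) (P : MvPolynomial (Tuple n s) K) :
    Ideal.Quotient.mk (grassmannianIdeal K n s) P ∈ idealOf K X ↔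
      P ∈ MvPolynomial.vanishingIdeal K (cone K X) := by
  have hle : grassmannianIdeal K n s ≤ MvPolynomial.vanishingIdeal K (cone K X) := by
    apply MvPolynomial.vanishingIdeal_anti_mono
    rintro x ⟨U, hU, h⟩
    exact ⟨U, hX hU, h⟩
  rw [idealOf, Ideal.mem_quotient_iff_mem_sup, sup_eq_left.2 hle]

/-- Taking the Zariski closure does not change the ideal of vanishing polynomials. -/
lemma mk_mem_schubertIdeal_iff {l : ℕ} (hcell : cell K n s l ⊆ grassmannian K n s)
    (P : MvPolynomial (Tuple n s) K) :
    Ideal.Quotient.mk (grassmannianIdeal K n s) P ∈ schubertIdeal K n s l ↔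
      P ∈ MvPolynomial.vanishingIdeal K (cone K (cell K n s l)) := by
  rw [schubertIdeal, mk_mem_idealOf_iff fun U hU => hU.1]
  simp only [MvPolynomial.mem_vanishingIdeal_iff]
  constructor
  · rintro h x ⟨U, hU, M, hM, a, rfl⟩
    refine h _ ⟨U, ⟨hcell hU, ?_⟩, M, hM, a, rfl⟩
    rintro y ⟨V, hV, M', hM', a', rfl⟩
    rw [MvPolynomial.mem_zeroLocus_iff]
    intro q hq
    rw [Set.mem_singleton_iff] at hV
    subst hV
    exact MvPolynomial.mem_vanishingIdeal_iff.1 hq _ ⟨V, hU, M', hM', a', rfl⟩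
  · rintro h x ⟨U, hU, M, hM, a, rfl⟩
    have := hU.2 ⟨U, rfl, M, hM, a, rfl⟩
    rw [MvPolynomial.mem_zeroLocus_iff] at this
    exact this P (MvPolynomial.mem_vanishingIdeal_iff.2 h)

lemma linearForm_mem_schubertIdeal_iff {l : ℕ} (hcell : cell K n s l ⊆ grassmannian K n s)
    (c : Tuple n s → K) :
    linearForm c ∈ schubertIdeal K n s l ↔
      ∀ M : Matrix (Fin (s * n * n)) (Fin (s * n)) K,
        LinearMap.range M.mulVecLin ∈ cell K n s l → ∑ I, c I * pluckerVector K M I = 0 := by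
  rw [linearForm_eq_mk, mk_mem_schubertIdeal_iff hcell, MvPolynomial.mem_vanishingIdeal_iff]
  constructor
  · intro h M hM
    simpa using h (pluckerVector K M) ⟨_, hM, M, rfl, 1, (one_smul _ _).symm⟩
  · rintro h _ ⟨U, hU, M, rfl, a, rfl⟩
    have := h M hU
    simp only [map_sum, map_smul, MvPolynomial.aeval_X, Pi.smul_apply, smul_eq_mul]
    rw [← mul_zero a, ← this, Finset.mul_sum]
    exact Finset.sum_congr rfl fun I _ => by ring

lemma exists_linearForm_of_mem_degreeOne {f : CoordRing K n s} (hf : f ∈ degreeOne K n s) :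
    ∃ c : Tuple n s → K, linearForm c = f := by
  obtain ⟨P, hP, rfl⟩ := hf
  rw [SetLike.mem_coe, MvPolynomial.mem_homogeneousSubmodule] at hP
  refine ⟨fun I => MvPolynomial.coeff (Finsupp.single I 1) P, ?_⟩
  rw [linearForm_eq_mk]
  change _ = Ideal.Quotient.mk _ P
  congr 1
  classical
  ext μ
  rw [MvPolynomial.coeff_sum]
  simp only [MvPolynomial.coeff_smul, MvPolynomial.coeff_X, smul_eq_mul, mul_ite, mul_one,
    mul_zero]
  by_cases hμ : ∃ I, Finsupp.single I 1 = μ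
  · obtain ⟨I, rfl⟩ := hμ
    rw [Finset.sum_eq_single I]
    · simp
    · intro J _ hJ
      rw [if_neg]
      intro h
      exact hJ (Finsupp.single_left_injective one_ne_zero h)
    · simp
  · push Not at hμ
    rw [Finset.sum_eq_zero fun I _ => if_neg (hμ I)]
    by_contra hne
    have h1 : μ.degree = 1 := by
      rw [Finsupp.degree_eq_weight_one]
      exact hP (Ne.symm hne)
    obtain ⟨I, hI⟩ : ∃ I, μ I ≠ 0 := by
      by_contra hcon
      push Not at hcon
      rw [show μ = 0 from Finsupp.ext hcon, map_zero] at h1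
      exact zero_ne_one h1
    have h2 : Finsupp.single I 1 ≤ μ := Finsupp.single_le_iff.2 (Nat.one_le_iff_ne_zero.2 hI)
    have h3 := congrArg Finsupp.degree (add_tsub_cancel_of_le h2)
    rw [map_add, Finsupp.degree_single, h1, Nat.add_eq_left, Finsupp.degree_eq_zero_iff,
      tsub_eq_zero_iff_le] at h3
    exact hμ I (le_antisymm h2 h3)

lemma linearForm_mem_degreeOne (c : Tuple n s → K) : linearForm c ∈ degreeOne K n s := by
  rw [linearForm_eq_mk]
  refine ⟨_, ?_, rfl⟩
  exact Submodule.sum_mem _ fun I _ => Submodule.smul_mem _ _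
    ((MvPolynomial.mem_homogeneousSubmodule _ _).2 (MvPolynomial.isHomogeneous_X _ _))

/-- A matrix with the same column space has proportional Plücker coordinates. -/
lemma exists_pluckerVector_eq_smul {M M' : Matrix (Fin (s * n * n)) (Fin (s * n)) K}
    (h : LinearMap.range M.mulVecLin ≤ LinearMap.range M'.mulVecLin) :
    ∃ a : K, pluckerVector K M = a • pluckerVector K M' := by
  have hcol : ∀ b, ∃ v : Fin (s * n) → K, M'.mulVec v = M.col b := by
    intro b
    have : M.col b ∈ LinearMap.range M'.mulVecLin := h ⟨Pi.single b 1, by simp⟩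
    exact this
  choose v hv using hcol
  have hM : M = M' * Matrix.of fun i b => v b i := by
    ext m b
    exact (congrFun (hv b) m).symm
  refine ⟨(Matrix.of fun i b => v b i).det, ?_⟩
  funext I
  rw [Pi.smul_apply, smul_eq_mul, mul_comm]
  unfold pluckerVector
  rw [← Matrix.det_mul]
  congr 1
  rw [hM]
  rfl

/-- The linear forms vanishing on `X(τ_ℓ)`: the straightening relations hold, and the coordinates
admissible on `X(τ_ℓ)` are linearly independent. -/
lemma standard_monomials_degree_one [Infinite K] (hn : 1 ≤ n) {l : ℕ} (h1 : 1 ≤ l)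
    (hl : l ≤ s * n * (n - 1) + 1) :
    (∀ c : Tuple n s → K, (∀ M : Matrix (Fin (s * n * n)) (Fin (s * n)) K, ShiftStable n M →
      ∑ I, c I * pluckerVector K M I = 0) → linearForm c ∈ schubertIdeal K n s l) ∧
    ∀ c : Tuple n s → K, (∀ S, c S ≠ 0 → IsAdmissibleOn K l S) →
      linearForm c ∈ schubertIdeal K n s l → c = 0 := by
  classical
  obtain ⟨d, hd, hk, hd2, hcell⟩ := exists_mem_cell_iff K hn s l h1 hl
  have hrN : s * n ≤ s * n * n := Nat.le_mul_of_pos_right _ hn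
  have hsub : cell K n s l ⊆ grassmannian K n s := by
    intro U hU
    obtain ⟨x, hx, hxl, rfl⟩ := (hcell U).1 hU
    change Module.finrank K _ = s * n
    rw [LinearMap.finrank_range_of_inj
      (injective_mulVecLin_cyclicMatrix hrN hd hn hk hx hxl)]
    simp
  have hmem : ∀ c : Tuple n s → K, linearForm c ∈ schubertIdeal K n s l ↔
      ∀ x : ℕ → K, (∀ m < l - 1, x m = 0) → x (l - 1) ≠ 0 →
        ∑ I, c I * pluckerVector K (cyclicMatrix (s * n * n) (s * n) n d x) I = 0 := by
    intro c
    rw [linearForm_mem_schubertIdeal_iff hsub]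
    constructor
    · intro h x hx hxl
      exact h _ ((hcell _).2 ⟨x, hx, hxl, rfl⟩)
    · intro h M hM
      obtain ⟨x, hx, hxl, hMx⟩ := (hcell _).1 hM
      obtain ⟨a, ha⟩ := exists_pluckerVector_eq_smul hMx.le
      rw [ha, ← mul_zero a, ← h x hx hxl, Finset.mul_sum]
      exact Finset.sum_congr rfl fun I _ => by rw [Pi.smul_apply, smul_eq_mul]; ring
  refine ⟨fun c hc => (hmem c).2 fun x hx _ =>
    hc _ (shiftStable_cyclicMatrix hrN hd hn hd2 hx), fun c hc hcI => ?_⟩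
  refine eq_zero_of_sum_dominant_eq_zero hn c (fun S hS => ?_) ((hmem c).1 hcI)
  obtain ⟨hadm, hp⟩ := hc S hS
  rw [← linearForm_single, hmem] at hp
  push Not at hp
  obtain ⟨x, hx, -, hne⟩ := hp
  refine isDominant_of_isAdmissible hx hadm ?_
  simpa [Pi.single_apply] using hne

open Classical in
lemma straighteningForm_eq_linearForm (l : ℕ) (I : Tuple n s) (b : Tuple n s → K) :
    straighteningForm K l I b =
      linearForm (Pi.single I 1 - fun S => if IsAdmissibleOn K l S then b S else 0) := by
  rw [map_sub, linearForm_single, linearForm_apply, straighteningForm, Finset.sum_filter]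
  simp only [ite_smul, zero_smul]

end LinearForms

end AffineSchubert

end

/-! ### Straightening and the degree-one part of the ideal. -/

theorem corollary4p11 (K : Type*) [Field K] [IsAlgClosed K] (n s : ℕ) (hn : 1 ≤ n) :
    ∃ a : AffineSchubert.Tuple n s → AffineSchubert.Tuple n s → K,
      ∀ l : ℕ, 1 ≤ l → l ≤ s * n * (n - 1) + 1 →
        (∀ I : AffineSchubert.Tuple n s, ¬ AffineSchubert.IsAdmissible I →
          ∀ b : AffineSchubert.Tuple n s → K,
            AffineSchubert.straighteningForm K l I b ∈ AffineSchubert.schubertIdeal K n s l ↔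
              ∀ S, AffineSchubert.IsAdmissibleOn K l S → b S = a I S) ∧
        AffineSchubert.degreeOnePart K (AffineSchubert.schubertIdeal K n s l) =
          Submodule.span K
            ({f | ∃ I : AffineSchubert.Tuple n s, ¬ AffineSchubert.IsAdmissible I ∧
                AffineSchubert.p K I ∉ AffineSchubert.schubertIdeal K n s l ∧
                f = AffineSchubert.straighteningForm K l I (a I)} ∪
             {f | ∃ I : AffineSchubert.Tuple n s, f = AffineSchubert.p K I ∧
                AffineSchubert.p K I ∈ AffineSchubert.schubertIdeal K n s l}) := by
  classical
  open AffineSchubert in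
  have : Infinite K := IsAlgClosed.instInfinite
  -- The coefficients are fixed before ℓ is introduced.
  choose a ha hstraight using fun I : Tuple n s => exists_straightening K hn (I : Fin (s * n) → _)
  refine ⟨a, fun l h1 hl => ?_⟩
  obtain ⟨hrel, hind⟩ := standard_monomials_degree_one (K := K) hn h1 hl
  have hform : ∀ I, straighteningForm K l I (a I) ∈ schubertIdeal K n s l := by
    intro I
    have hglobal : linearForm (Pi.single I 1 - a I) ∈ schubertIdeal K n s l := by
      refine hrel _ fun M hM => ?_
      have h2 : pluckerVector K M I = _ := hstraight I M hM
      simp only [Pi.sub_apply, sub_mul, Finset.sum_sub_distrib, ← h2, Pi.single_apply, ite_mul,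
        one_mul, zero_mul, Finset.sum_ite_eq', Finset.mem_univ, if_true, sub_self]
    -- The discarded terms lie in the ideal: either S is not admissible and its coefficient is zero,
    -- or p_S vanishes on X(τ_ℓ).
    have hrest : linearForm (a I - fun S => if IsAdmissibleOn K l S then a I S else 0) ∈
        schubertIdeal K n s l := by
      rw [linearForm_apply]
      refine Ideal.sum_mem _ fun S _ => ?_
      by_cases hS : IsAdmissibleOn K l S
      · simp [hS]
      · by_cases hadm : IsAdmissible S
        · have hp : p K S ∈ schubertIdeal K n s l := by
            by_contra hp; exact hS ⟨hadm, hp⟩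
          exact Submodule.smul_of_tower_mem _ _ hp
        · simp [hS, ha I S hadm]
    rw [straighteningForm_eq_linearForm]
    have := Ideal.add_mem _ hglobal hrest
    rwa [← map_add, sub_add_sub_cancel] at this
  refine ⟨fun I _ b => ⟨fun hb S hS => ?_, fun hb => ?_⟩, ?_⟩
  -- The difference of two straightening relations involves only coordinates admissible on X(τ_ℓ),
  -- so independence makes it trivial.
  · have h2 := Ideal.sub_mem _ (hform I) hb
    rw [straighteningForm_eq_linearForm, straighteningForm_eq_linearForm, ← map_sub] at h2
    have h3 := congrFun (hind _ (fun T hT => ?_) h2) S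
    · simpa [hS, sub_eq_zero] using h3
    · by_contra hT'
      simp [hT'] at hT
  · have : straighteningForm K l I b = straighteningForm K l I (a I) := by
      rw [straighteningForm_eq_linearForm, straighteningForm_eq_linearForm]
      congr 2
      funext S
      split_ifs with hS
      · exact hb S hS
      · rfl
    rw [this]
    exact hform I
  · set G := Submodule.span K
      ({f | ∃ I : Tuple n s, ¬ IsAdmissible I ∧ p K I ∉ schubertIdeal K n s l ∧
          f = straighteningForm K l I (a I)} ∪
        {f | ∃ I : Tuple n s, f = p K I ∧ p K I ∈ schubertIdeal K n s l}) with hG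
    have hle : G ≤ degreeOnePart K (schubertIdeal K n s l) := by
      rw [hG, Submodule.span_le]
      rintro f (⟨I, -, -, rfl⟩ | ⟨I, rfl, hI⟩)
      · refine ⟨hform I, ?_⟩
        rw [straighteningForm_eq_linearForm]
        exact linearForm_mem_degreeOne _
      · refine ⟨hI, ?_⟩
        rw [← linearForm_single]
        exact linearForm_mem_degreeOne _
    refine le_antisymm ?_ hle
    -- Modulo the proposed generators, every Plücker coordinate reduces to coordinates admissible on
    -- X(τ_ℓ). A linear form in the ideal then reduces to a combination still in the ideal, which is
    -- zero by independence.
    have hred : ∀ I : Tuple n s, ∃ b : Tuple n s → K, (∀ S, b S ≠ 0 → IsAdmissibleOn K l S) ∧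
        p K I - linearForm b ∈ G := by
      intro I
      by_cases hp : p K I ∈ schubertIdeal K n s l
      · refine ⟨0, fun S hS => absurd rfl hS, ?_⟩
        rw [map_zero, sub_zero]
        exact Submodule.subset_span (Or.inr ⟨I, rfl, hp⟩)
      · by_cases hI : IsAdmissible I
        · refine ⟨Pi.single I 1, fun S hS => ?_, ?_⟩
          · by_cases hSI : S = I
            · rw [hSI]; exact ⟨hI, hp⟩
            · exact absurd (Pi.single_eq_of_ne hSI _) hS
          · rw [linearForm_single, sub_self]
            exact G.zero_mem
        · refine ⟨fun S => if IsAdmissibleOn K l S then a I S else 0, fun S hS => ?_, ?_⟩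
          · by_contra hS'
            exact hS (if_neg hS')
          · rw [← linearForm_single, ← map_sub, ← straighteningForm_eq_linearForm]
            exact Submodule.subset_span (Or.inl ⟨I, hI, hp, rfl⟩)
    choose b hb hbG using hred
    rintro f ⟨hf1, hf2⟩
    obtain ⟨c, rfl⟩ := exists_linearForm_of_mem_degreeOne hf2
    have hsplit : linearForm c - linearForm (∑ I, c I • b I) ∈ G := by
      rw [linearForm_apply c, map_sum, ← Finset.sum_sub_distrib]
      refine Submodule.sum_mem _ fun I _ => ?_
      rw [map_smul, ← smul_sub]
      exact Submodule.smul_mem _ _ (hbG I)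
    have hzero : (∑ I, c I • b I) = 0 := by
      refine hind _ (fun S hS => ?_) ?_
      · rw [Finset.sum_apply] at hS
        obtain ⟨I, -, hI⟩ := Finset.exists_ne_zero_of_sum_ne_zero hS
        exact hb I S (right_ne_zero_of_mul hI)
      · have := Ideal.sub_mem _ hf1 (hle hsplit).1
        rwa [sub_sub_cancel] at this
    rwa [hzero, map_zero, sub_zero] at hsplit
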